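/- **Games.** A game $A$ is a partially ordered set of moves $(M_A,\le_A)$ in which every move has finitely many predecessors, with a polarity $\lambda_A:M_A\to\{-1,+1\}$ ($+1$: Proponent, $-1$: Opponent). $A^*$ is $A$ with inverted polarities, $A\otimes B$ is the disjoint union, $A\multimap B=A^*\otimes B$, and $A\varolessthan B$ ("$A$ before $B$") is the disjoint union in which moreover every move of $A$ is below every move of $B$. $I$ is the empty game; $O$, resp. $P$, is the game with exactly one Opponent, resp. Proponent, move. A game is finite filiform if it is finite and totally ordered. A *cyclic strategy* on $A$ is a reflexive transitive relation $\sigma$ on $M_A$ such that $m\mathrel\sigma n$ and $m\ne n$ imply $\lambda_A(m)=-1$ and $\lambda_A(n)=+1$. It is a *strategy* if it is a partial order and the transitive closure of $\sigma\cup{\le_A}$ is a partial order. The composite of cyclic strategies $\sigma$ on $A\multimap B$ and $\tau$ on $B\multimap C$ is the restriction to $M_A\uplus M_C$ of the transitive closure of $\sigma\cup\tau$ on $M_A\uplus M_B\uplus M_C$; the identity on $A\multimap A$ relates the two copies of each move, from the Opponent copy to the Proponent copy. $\mathbf{Games}$ is the smallest category, with this composition and these identities, whose objects are the finite filiform games and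 whose morphisms $A\to B$ include all strategies on $A\multimap B$. **Logic.** Fix a first-order language $\mathcal L$ with countably infinitely many variables, obtained from an arbitrary one by adding function symbols $\top,\bot$ (nullary) and $\wedge,\vee$ (binary), a unary proposition symbol $I$ and nullary proposition symbols $\top,\bot$, and by closing the proposition symbols under formal conjunction and disjunction (if $P(\vec s)$ and $Q(\vec t)$ are propositions, so are $P(\vec s)\wedge Q(\vec t)$ and $P(\vec s)\vee Q(\vec t)$). Formulas are $A::=P(t_1,\dots,t_n)\mid\forall x\,A\mid\exists x\,A$, up to renaming of bound variables. A set of axioms is a reflexive and transitive set $\mathrm{Ax}$ of pairs of propositions, closed under substitution. The rules for sequents $A\vdash B$ are: $P\vdash Q$ for $(P,Q)\in\mathrm{Ax}$; from $A[t/x]\vdash B$ infer $\forall x A\vdash B$; from $A\vdash B$ infer $A\vdash\forall x B$ ($x$ not free in $A$); from $A\vdash B$ infer $\exists x A\vdash B$ ($x$ not free in $B$); from $A\vdash B[t/x]$ infer $A\vdash\exists x B$; and cut. Let $\mathrm{Ax}_0$ be the smallest reflexive transitive set of pairs of propositions such that, for all propositions and all terms $s,t$: * $(P,\top),(\bot,P)\in\mathrm{Ax}_0$;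 * if $(P,P_1)\in\mathrm{Ax}_0$ and $(P,P_2)\in\mathrm{Ax}_0$ then $(P,P_1\wedge P_2)\in\mathrm{Ax}_0$; if $(P,P_1)\in\mathrm{Ax}_0$ or $(P,P_2)\in\mathrm{Ax}_0$ then $(P,P_1\vee P_2)\in\mathrm{Ax}_0$; * if $(P_1,P)\in\mathrm{Ax}_0$ or $(P_2,P)\in\mathrm{Ax}_0$ then $(P_1\wedge P_2,P)\in\mathrm{Ax}_0$; if $(P_1,P)\in\mathrm{Ax}_0$ and $(P_2,P)\in\mathrm{Ax}_0$ then $(P_1\vee P_2,P)\in\mathrm{Ax}_0$; * $I(\top)$, $I(\bot)$, $I(s\wedge t)$, $I(s\vee t)$ are equivalent (related in both directions) to $\top$, $\bot$, $I(s)\wedge I(t)$, $I(s)\vee I(t)$ respectively. **Interpretation.** $[\![P(\vec t)]\!]=I$, $[\![\forall x A]\!]=O\varolessthan[\![A]\!]$, $[\![\exists x A]\!]=P\varolessthan[\![A]\!]$; so moves are quantifier occurrences. A cut-free proof $\pi$ of $A\vdash B$ (with pairwise distinct variables chosen for the rules $\forall$-R and $\exists$-L, not occurring free below the rule) is interpreted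 as the following strategy $[\![\pi]\!]$ on $[\![A]\!]\multimap[\![B]\!]$: for $m\neq n$, $m\le n$ holds iff $n$ is introduced by a rule $\forall$-L or $\exists$-R with a witness term $t$, $m$ is introduced by a rule $\forall$-R or $\exists$-L with variable $x$, this rule is below the rule introducing $n$, and $x$ is free in $t$. **Theorem.** $\mathrm{Ax}_0$ is a set of axioms (reflexive, transitive, closed under substitution), and it is coherent: the sequent $\top\vdash\bot$ has no proof (even with cuts). For every set of axioms $\mathrm{Ax}\supseteq\mathrm{Ax}_0$, in particular for $\mathrm{Ax}_0$ itself, every morphism $\sigma:A\to B$ of $\mathbf{Games}$ is definable: there are formulas $F,G$ with $[\![F]\!]\cong A$ and $[\![G]\!]\cong B$, and a cut-free proof $\pi$ of $F\vdash G$ over $\mathrm{Ax}$ such that, along these isomorphisms, $\sigma=[\![\pi]\!]$. -/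

import Mathlib

universe u v w

/-! ## Games and strategies -/

/-- A game: moves with a polarity (`1` for Proponent, `-1` for Opponent) and a causality partial
order in which every move has finitely many predecessors. -/
structure Game : Type (u + 1) where
  Move : Type u
  [order : PartialOrder Move]
  pol : Move → ℤˣ
  finite_down : ∀ m : Move, {n : Move | n ≤ m}.Finite

namespace Game

attribute [instance] Game.order

/-- The empty game. -/
def empty : Game.{0} where
  Move := Empty
  pol := Empty.elim
  finite_down m := m.elim

/-- The game with exactly one move, of polarity `s`. -/
def single (s : ℤˣ) : Game.{0} where
  Move := Unit
  pol _ := s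
  finite_down _ := Set.toFinite _

/-- The game `O` with only one Opponent move. -/
def O : Game.{0} := single (-1)

/-- The game `P` with only one Proponent move. -/
def P : Game.{0} := single 1

/-- The tensor product: disjoint union of moves, polarities and causality
(Mathlib's order on `α ⊕ β` is the disjoint union of the two orders). -/
def tensor (A B : Game.{u}) : Game.{u} where
  Move := A.Move ⊕ B.Move
  pol := Sum.elim A.pol B.pol
  finite_down := by
    rintro (m | m)
    · refine ((A.finite_down m).image Sum.inl).subset ?_
      rintro (n | n) h
      · exact ⟨n, Sum.inl_le_inl_iff.1 h, rfl⟩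
      · exact absurd h Sum.not_inr_le_inl
    · refine ((B.finite_down m).image Sum.inr).subset ?_
      rintro (n | n) h
      · exact absurd h Sum.not_inl_le_inr
      · exact ⟨n, Sum.inr_le_inr_iff.1 h, rfl⟩

/-- The opposite game: polarities are inverted. -/
def dual (A : Game.{u}) : Game.{u} where
  Move := A.Move
  pol m := -A.pol m
  finite_down := A.finite_down

/-- The arrow game `A ⊸ B = A* ⊗ B`. -/
def arrow (A B : Game.{u}) : Game.{u} := tensor (dual A) B

/-- The game `A` before `B`: every move of `A` is put below every move of `B`. The game `A` has to
be finite for the result to be well-founded. -/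
def before (A B : Game.{u}) [Finite A.Move] : Game.{u} where
  Move := A.Move ⊕ B.Move
  order :=
    { le := Sum.Lex (· ≤ ·) (· ≤ ·)
      lt := fun x y => Sum.Lex (· ≤ ·) (· ≤ ·) x y ∧ ¬ Sum.Lex (· ≤ ·) (· ≤ ·) y x
      lt_iff_le_not_ge := fun _ _ => Iff.rfl
      le_refl := by rintro (a | a) <;> constructor <;> exact le_rfl
      le_trans := by
        rintro _ _ _ (h | h | _) (h' | h' | _)
        · exact .inl (h.trans h')
        · exact .sep _ _
        · exact .inr (h.trans h')
        · exact .sep _ _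
      le_antisymm := by
        rintro _ _ (h | h | _) (h' | h' | _)
        · exact congrArg _ (h.antisymm h')
        · exact congrArg _ (h.antisymm h') }
  pol := Sum.elim A.pol B.pol
  finite_down := by
    rintro (m | m)
    · refine (Set.finite_range (Sum.inl : A.Move → A.Move ⊕ B.Move)).subset ?_
      rintro _ (h | h | _)
      exact ⟨_, rfl⟩
    · refine ((Set.finite_range (Sum.inl : A.Move → A.Move ⊕ B.Move)).union
        ((B.finite_down m).image Sum.inr)).subset ?_
      rintro _ (h | h | _)
      · exact Or.inr ⟨_, h, rfl⟩
      · exact Or.inl ⟨_, rfl⟩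

/-- Finite filiform games: finitely many moves, totally ordered by causality. -/
structure FiniteFiliform (A : Game.{u}) : Prop where
  finite : Finite A.Move
  total : ∀ m n : A.Move, m ≤ n ∨ n ≤ m

/-- Isomorphisms of games. -/
structure Iso (A : Game.{u}) (B : Game.{v}) where
  toEquiv : A.Move ≃ B.Move
  le_iff : ∀ m n : A.Move, toEquiv m ≤ toEquiv n ↔ m ≤ n
  pol_eq : ∀ m : A.Move, B.pol (toEquiv m) = A.pol m

end Game

/-- A cyclic strategy on a game: a reflexive and transitive relation on its moves relating distinct
moves only from an Opponent move to a Proponent move. -/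
structure CyclicStrategy (A : Game.{u}) where
  rel : A.Move → A.Move → Prop
  refl : ∀ m, rel m m
  trans : ∀ l m n, rel l m → rel m n → rel l n
  polarity : ∀ m n, rel m n → m ≠ n → A.pol m = -1 ∧ A.pol n = 1

/-- A strategy on a game: a partial order on its moves satisfying the polarity condition, and such
that the transitive closure of its union with the causality of the game is a partial order. -/
structure Strategy (A : Game.{u}) extends CyclicStrategy A where
  antisymm : ∀ m n, rel m n → rel n m → m = n
  acyclic : ∀ m n, Relation.TransGen (fun a b => a ≤ b ∨ rel a b) m n →
    Relation.TransGen (fun a b => a ≤ b ∨ rel a b) n m → m = n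

namespace CyclicStrategy

/-- The identity of a game `A`, a cyclic strategy on `A ⊸ A`: each Proponent move of the target is
justified by its copy in the source, each Opponent move of the target justifies its copy in the
source. -/
def id (A : Game.{u}) : CyclicStrategy (A.arrow A) where
  rel := fun (x y : A.Move ⊕ A.Move) => x = y ∨
    (∃ m, A.pol m = 1 ∧ x = Sum.inl m ∧ y = Sum.inr m) ∨
    (∃ m, A.pol m = -1 ∧ x = Sum.inr m ∧ y = Sum.inl m)
  refl _ := Or.inl rfl
  trans := by
    rintro l m n (rfl | ⟨a, ha, rfl, rfl⟩ | ⟨a, ha, rfl, rfl⟩) h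
    · exact h
    · obtain h | ⟨b, hb, h, rfl⟩ | ⟨b, hb, h, rfl⟩ := h
      · exact Or.inr (Or.inl ⟨a, ha, rfl, h.symm⟩)
      · cases h
      · cases h
        rw [ha] at hb
        exact absurd hb (by decide)
    · obtain h | ⟨b, hb, h, rfl⟩ | ⟨b, hb, h, rfl⟩ := h
      · exact Or.inr (Or.inr ⟨a, ha, rfl, h.symm⟩)
      · cases h
        rw [ha] at hb
        exact absurd hb (by decide)
      · cases h
  polarity := by
    rintro m n (rfl | ⟨a, ha, rfl, rfl⟩ | ⟨a, ha, rfl, rfl⟩) hne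
    · exact absurd rfl hne
    · exact ⟨congrArg Neg.neg ha, ha⟩
    · exact ⟨ha, (congrArg Neg.neg ha).trans (neg_neg 1)⟩

variable {A B C : Game.{u}}

/-- The union of two relations on the moves of `A ⊸ B` and of `B ⊸ C`, as a relation on the
disjoint union of the moves of `A`, `B` and `C`. -/
def union (σ : CyclicStrategy (A.arrow B)) (τ : CyclicStrategy (B.arrow C)) :
    A.Move ⊕ (B.Move ⊕ C.Move) → A.Move ⊕ (B.Move ⊕ C.Move) → Prop := fun x y =>
  Relation.Map σ.rel (Sum.map _root_.id Sum.inl) (Sum.map _root_.id Sum.inl) x y ∨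
    Relation.Map τ.rel Sum.inr Sum.inr x y

theorem union_polarity (σ : CyclicStrategy (A.arrow B)) (τ : CyclicStrategy (B.arrow C))
    {x y : A.Move ⊕ (B.Move ⊕ C.Move)} (h : Relation.TransGen (union σ τ) x y) :
    x = y ∨
      ((∀ a, x = Sum.inl a → -A.pol a = -1) ∧ (∀ c, x = Sum.inr (Sum.inr c) → C.pol c = -1) ∧
        (∀ a, y = Sum.inl a → -A.pol a = 1) ∧ (∀ c, y = Sum.inr (Sum.inr c) → C.pol c = 1)) := by
  have step : ∀ x y, union σ τ x y → x = y ∨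
      ((∀ a, x = Sum.inl a → -A.pol a = -1) ∧ (∀ c, x = Sum.inr (Sum.inr c) → C.pol c = -1) ∧
        (∀ a, y = Sum.inl a → -A.pol a = 1) ∧
        (∀ c, y = Sum.inr (Sum.inr c) → C.pol c = 1)) := by
    rintro x y (⟨a, b, h, rfl, rfl⟩ | ⟨a, b, h, rfl, rfl⟩)
    · by_cases hab : a = b
      · exact Or.inl (by rw [hab])
      · have := σ.polarity a b h hab
        right
        rcases a with a | a <;> rcases b with b | b <;>
          refine ⟨?_, ?_, ?_, ?_⟩ <;> intro c hc <;> cases hc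
        all_goals first | exact this.1 | exact this.2
    · by_cases hab : a = b
      · exact Or.inl (by rw [hab])
      · have := τ.polarity a b h hab
        right
        rcases a with a | a <;> rcases b with b | b <;>
          refine ⟨?_, ?_, ?_, ?_⟩ <;> intro c hc <;> cases hc
        all_goals first | exact this.1 | exact this.2
  induction h with
  | single h => exact step _ _ h
  | tail _ h ih =>
    rcases step _ _ h with rfl | h'
    · exact ih
    · rcases ih with rfl | ih
      · exact Or.inr h'
      · exact Or.inr ⟨ih.1, ih.2.1, h'.2.2⟩

/-- The composite `τ ∘ σ`: the transitive closure of the union of the two relations, restricted to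
the moves of `A` and `C`. -/
def comp (σ : CyclicStrategy (A.arrow B)) (τ : CyclicStrategy (B.arrow C)) :
    CyclicStrategy (A.arrow C) where
  rel := fun (x y : A.Move ⊕ C.Move) =>
    Relation.TransGen (union σ τ) (Sum.map _root_.id Sum.inr x) (Sum.map _root_.id Sum.inr y)
  refl := by
    rintro (m | m)
    · exact .single (Or.inl ⟨Sum.inl m, Sum.inl m, σ.refl _, rfl, rfl⟩)
    · exact .single (Or.inr ⟨Sum.inr m, Sum.inr m, τ.refl _, rfl, rfl⟩)
  trans _ _ _ h h' := h.trans h'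
  polarity := by
    rintro m n h hne
    rcases union_polarity σ τ h with h | ⟨h1, h2, h3, h4⟩
    · rcases m with m | m <;> rcases n with n | n <;> cases h <;> exact absurd rfl hne
    · rcases m with m | m <;> rcases n with n | n
      · exact ⟨h1 _ rfl, h3 _ rfl⟩
      · exact ⟨h1 _ rfl, h4 _ rfl⟩
      · exact ⟨h2 _ rfl, h3 _ rfl⟩
      · exact ⟨h2 _ rfl, h4 _ rfl⟩

end CyclicStrategy

/-- The morphisms of the category `Games`: the smallest class of cyclic strategies `A ⊸ B` between
finite filiform games that contains all strategies and identities and is closed under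
composition. -/
inductive GamesHom : ∀ {A B : Game.{u}}, CyclicStrategy (A.arrow B) → Prop
  | ofStrategy {A B : Game.{u}} (hA : A.FiniteFiliform) (hB : B.FiniteFiliform)
      (σ : Strategy (A.arrow B)) : GamesHom σ.toCyclicStrategy
  | id {A : Game.{u}} (hA : A.FiniteFiliform) : GamesHom (CyclicStrategy.id A)
  | comp {A B C : Game.{u}} {σ : CyclicStrategy (A.arrow B)} {τ : CyclicStrategy (B.arrow C)}
      (hσ : GamesHom σ) (hτ : GamesHom τ) : GamesHom (σ.comp τ)

/-! ## Connective-free first-order logic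

The variables are the natural numbers, and binders use de Bruijn indices, so that formulas are
automatically considered up to renaming of bound variables: under a quantifier the variable `0` is
the bound one and the variable `n + 1` is the variable `n` of the outside. -/

/-- A proposition `P(t₁, …, tₙ)`: a proposition symbol applied to terms. -/
structure Proposition (L : FirstOrder.Language.{u, v}) where
  arity : ℕ
  sym : L.Relations arity
  args : Fin arity → L.Term ℕ

/-- Formulas, without connectives. -/
inductive QFormula (L : FirstOrder.Language.{u, v})
  | atom (P : Proposition L) : QFormula L
  | all (A : QFormula L) : QFormula L
  | ex (A : QFormula L) : QFormula L

section Substitution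

variable {L : FirstOrder.Language.{u, v}}

/-- Simultaneous substitution in a proposition. -/
def Proposition.subst (P : Proposition L) (s : ℕ → L.Term ℕ) : Proposition L :=
  ⟨P.arity, P.sym, fun i => (P.args i).subst s⟩

/-- A substitution carried under a quantifier. -/
def liftSubst (s : ℕ → L.Term ℕ) : ℕ → L.Term ℕ
  | 0 => FirstOrder.Language.Term.var 0
  | n + 1 => (s n).relabel Nat.succ

/-- Simultaneous capture-avoiding substitution in a formula. -/
def QFormula.subst : QFormula L → (ℕ → L.Term ℕ) → QFormula L
  | .atom P, s => .atom (P.subst s)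
  | .all A, s => .all (A.subst (liftSubst s))
  | .ex A, s => .ex (A.subst (liftSubst s))

/-- `A[t/x]`, for the body `A` of a quantifier on `x`. -/
def QFormula.inst (A : QFormula L) (t : L.Term ℕ) : QFormula L :=
  A.subst fun | 0 => t | n + 1 => FirstOrder.Language.Term.var n

/-- The formula `A`, seen in the scope of one more variable `0`, not free in it. -/
def QFormula.shift (A : QFormula L) : QFormula L :=
  A.subst fun n => FirstOrder.Language.Term.var (n + 1)

/-- The standing conditions on a set of axioms: it is reflexive, transitive and closed under
substitution. -/
structure IsAxiomSet (Ax : Set (Proposition L × Proposition L)) : Prop where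
  refl : ∀ P, (P, P) ∈ Ax
  trans : ∀ P Q R, (P, Q) ∈ Ax → (Q, R) ∈ Ax → (P, R) ∈ Ax
  subst : ∀ P Q (s : ℕ → L.Term ℕ), (P, Q) ∈ Ax → (P.subst s, Q.subst s) ∈ Ax

/-- Proofs of sequents `A ⊢ B`. In `allR` and `exL` the variable `0` of the premise is the variable
of the quantifier that the rule introduces, and it is not free in the other formula. -/
inductive SeqProof (Ax : Set (Proposition L × Proposition L)) :
    QFormula L → QFormula L → Type (max u v)
  | allL {A B : QFormula L} (t : L.Term ℕ) (π : SeqProof Ax (A.inst t) B) : SeqProof Ax (.all A) B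
  | allR {A B : QFormula L} (π : SeqProof Ax A.shift B) : SeqProof Ax A (.all B)
  | exL {A B : QFormula L} (π : SeqProof Ax A B.shift) : SeqProof Ax (.ex A) B
  | exR {A B : QFormula L} (t : L.Term ℕ) (π : SeqProof Ax A (B.inst t)) : SeqProof Ax A (.ex B)
  | ax {P Q : Proposition L} (h : (P, Q) ∈ Ax) : SeqProof Ax (.atom P) (.atom Q)
  | cut {A B C : QFormula L} (π : SeqProof Ax A B) (π' : SeqProof Ax B C) : SeqProof Ax A C

end Substitution

/-! ## The interpretation of formulas and of cut-free proofs -/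

section Interpretation

variable {L : FirstOrder.Language.{u, v}}

instance (s : ℤˣ) : Finite (Game.single s).Move := inferInstanceAs (Finite Unit)

instance : Finite Game.O.Move := inferInstanceAs (Finite Unit)

instance : Finite Game.P.Move := inferInstanceAs (Finite Unit)

/-- The game interpreting a formula. -/
def QFormula.interp : QFormula L → Game.{0}
  | .atom _ => Game.empty
  | .all A => Game.before Game.O A.interp
  | .ex A => Game.before Game.P A.interp

/-- The number of quantifiers in front of the quantifier that a move interprets. -/
def QFormula.depth : (A : QFormula L) → A.interp.Move → ℕ
  | .atom _ => Empty.elim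
  | .all A => Sum.elim (fun _ => 0) fun m => A.depth m + 1
  | .ex A => Sum.elim (fun _ => 0) fun m => A.depth m + 1

/-- The quantifiers of a sequent `A ⊢ B`: `inl n` is the `n`-th quantifier of `A` (from the outside,
starting with `0`) and `inr n` is the `n`-th quantifier of `B`. -/
abbrev Position : Type := ℕ ⊕ ℕ

/-- The assignment `ρ` of positions to variables, extended by `p` for a new variable `0`. -/
def consPos (p : Position) (ρ : ℕ → Option Position) : ℕ → Option Position
  | 0 => some p
  | n + 1 => ρ n

namespace SeqProof

variable {Ax : Set (Proposition L × Proposition L)}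

/-- Proofs without the cut rule. -/
def CutFree : {A B : QFormula L} → SeqProof Ax A B → Prop
  | _, _, .allL _ π => π.CutFree
  | _, _, .allR π => π.CutFree
  | _, _, .exL π => π.CutFree
  | _, _, .exR _ π => π.CutFree
  | _, _, .ax _ => True
  | _, _, .cut _ _ => False

/-- `π.Justifies h i j ρ p q` says that, in the cut-free proof `π`, the quantifier `q` is introduced
by a rule `∀`-L or `∃`-R with a witness term in which there is a free variable `x` which is the
variable of the quantifier `p`, introduced by a rule `∀`-R or `∃`-L. The proof `π` is the part of a
larger proof that remains once the first `i` quantifiers on the left and the first `j` on the right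
of its conclusion have been introduced, and `ρ` records which of the variables were introduced by
which of these quantifiers. -/
def Justifies : {A B : QFormula L} → (π : SeqProof Ax A B) → π.CutFree →
    ℕ → ℕ → (ℕ → Option Position) → Position → Position → Prop
  | _, _, .allL t π, h, i, j, ρ, p, q =>
      (q = Sum.inl i ∧ ∃ x ∈ t.varFinset, ρ x = some p) ∨ π.Justifies h (i + 1) j ρ p q
  | _, _, .allR π, h, i, j, ρ, p, q => π.Justifies h i (j + 1) (consPos (Sum.inr j) ρ) p q
  | _, _, .exL π, h, i, j, ρ, p, q => π.Justifies h (i + 1) j (consPos (Sum.inl i) ρ) p q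
  | _, _, .exR t π, h, i, j, ρ, p, q =>
      (q = Sum.inr j ∧ ∃ x ∈ t.varFinset, ρ x = some p) ∨ π.Justifies h i (j + 1) ρ p q
  | _, _, .ax _, _, _, _, _, _, _ => False
  | _, _, .cut _ _, h, _, _, _, _, _ => False.elim h


/-- The number of quantifiers introduced below the rule introducing a given quantifier. -/
def rank : {A B : QFormula L} → SeqProof Ax A B → ℕ → ℕ → Position → ℕ
  | _, _, .allL _ π, i, j, p => if p = Sum.inl i then i + j else π.rank (i + 1) j p
  | _, _, .allR π, i, j, p => if p = Sum.inr j then i + j else π.rank i (j + 1) p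
  | _, _, .exL π, i, j, p => if p = Sum.inl i then i + j else π.rank (i + 1) j p
  | _, _, .exR _ π, i, j, p => if p = Sum.inr j then i + j else π.rank i (j + 1) p
  | _, _, .ax _, i, j, _ => i + j
  | _, _, .cut _ _, i, j, _ => i + j

end SeqProof

/-- The polarity of the `n`-th quantifier of a formula. -/
def QFormula.polAt : QFormula L → ℕ → Option ℤˣ
  | .atom _, _ => none
  | .all _, 0 => some (-1)
  | .ex _, 0 => some 1
  | .all A, n + 1 => A.polAt n
  | .ex A, n + 1 => A.polAt n

theorem QFormula.polAt_subst (A : QFormula L) : ∀ (s : ℕ → L.Term ℕ) (n : ℕ),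
    (A.subst s).polAt n = A.polAt n := by
  induction A with
  | atom P => intro s n; rfl
  | all A ih => intro s n; cases n with
    | zero => rfl
    | succ n => exact ih _ _
  | ex A ih => intro s n; cases n with
    | zero => rfl
    | succ n => exact ih _ _

theorem QFormula.polAt_depth : ∀ (A : QFormula L) (m : A.interp.Move),
    A.polAt (A.depth m) = some (A.interp.pol m)
  | .atom _, m => Empty.elim m
  | .all _, .inl _ => rfl
  | .all A, .inr m => A.polAt_depth m
  | .ex _, .inl _ => rfl
  | .ex A, .inr m => A.polAt_depth m

theorem QFormula.depth_mono : ∀ (A : QFormula L) (m n : A.interp.Move), m ≤ n →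
    m = n ∨ A.depth m < A.depth n
  | .atom _, m, _, _ => Empty.elim m
  | .all _, .inl _, .inl _, _ => Or.inl rfl
  | .all _, .inl _, .inr _, _ => Or.inr (Nat.succ_pos _)
  | .all A, .inr m, .inr n, h =>
      (A.depth_mono m n (by cases h; assumption)).imp (congrArg _) Nat.succ_lt_succ
  | .all _, .inr _, .inl _, h => by cases h
  | .ex _, .inl _, .inl _, _ => Or.inl rfl
  | .ex _, .inl _, .inr _, _ => Or.inr (Nat.succ_pos _)
  | .ex A, .inr m, .inr n, h =>
      (A.depth_mono m n (by cases h; assumption)).imp (congrArg _) Nat.succ_lt_succ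
  | .ex _, .inr _, .inl _, h => by cases h

/-- The polarity of a quantifier of a sequent, of which the first `i` and `j` quantifiers on the two
sides have been removed. -/
def seqPol (A B : QFormula L) (i j : ℕ) : Position → Option ℤˣ
  | .inl n => if i ≤ n then (A.polAt (n - i)).map Neg.neg else none
  | .inr n => if j ≤ n then B.polAt (n - j) else none

theorem seqPol_allL (A B : QFormula L) (s : ℕ → L.Term ℕ) (i j : ℕ) (q : Position) :
    seqPol (.all A) B i j q = if q = Sum.inl i then some 1 else seqPol (A.subst s) B (i + 1) j q := by
  rcases q with n | n
  · rcases lt_trichotomy n i with h | rfl | h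
    · simp [seqPol, h.ne, not_le.2 h, not_le.2 (Nat.lt_succ_of_lt h)]
    · simp [seqPol, QFormula.polAt]
    · obtain ⟨k, rfl⟩ := Nat.exists_eq_add_of_lt h
      have e : i + k + 1 - i = k + 1 := by omega
      have e' : i + k + 1 - (i + 1) = k := by omega
      have e'' : i ≤ i + k + 1 := by omega
      have e3 : i + k + 1 ≠ i := by omega
      simp [seqPol, QFormula.polAt, QFormula.polAt_subst, e, e', e'', e3]
  · simp [seqPol]

theorem seqPol_exL (A B : QFormula L) (s : ℕ → L.Term ℕ) (i j : ℕ) (q : Position) :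
    seqPol (.ex A) B i j q =
      if q = Sum.inl i then some (-1) else seqPol A (B.subst s) (i + 1) j q := by
  rcases q with n | n
  · rcases lt_trichotomy n i with h | rfl | h
    · simp [seqPol, h.ne, not_le.2 h, not_le.2 (Nat.lt_succ_of_lt h)]
    · simp [seqPol, QFormula.polAt]
    · obtain ⟨k, rfl⟩ := Nat.exists_eq_add_of_lt h
      have e : i + k + 1 - i = k + 1 := by omega
      have e' : i + k + 1 - (i + 1) = k := by omega
      have e'' : i ≤ i + k + 1 := by omega
      have e3 : i + k + 1 ≠ i := by omega
      simp [seqPol, QFormula.polAt, e, e', e'', e3]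
  · simp [seqPol, QFormula.polAt_subst]

theorem seqPol_allR (A B : QFormula L) (s : ℕ → L.Term ℕ) (i j : ℕ) (q : Position) :
    seqPol A (.all B) i j q =
      if q = Sum.inr j then some (-1) else seqPol (A.subst s) B i (j + 1) q := by
  rcases q with n | n
  · simp [seqPol, QFormula.polAt_subst]
  · rcases lt_trichotomy n j with h | rfl | h
    · simp [seqPol, h.ne, not_le.2 h, not_le.2 (Nat.lt_succ_of_lt h)]
    · simp [seqPol, QFormula.polAt]
    · obtain ⟨k, rfl⟩ := Nat.exists_eq_add_of_lt h
      have e : j + k + 1 - j = k + 1 := by omega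
      have e' : j + k + 1 - (j + 1) = k := by omega
      have e'' : j ≤ j + k + 1 := by omega
      have e3 : j + k + 1 ≠ j := by omega
      simp [seqPol, QFormula.polAt, e, e', e'', e3]

theorem seqPol_exR (A B : QFormula L) (s : ℕ → L.Term ℕ) (i j : ℕ) (q : Position) :
    seqPol A (.ex B) i j q = if q = Sum.inr j then some 1 else seqPol A (B.subst s) i (j + 1) q := by
  rcases q with n | n
  · simp [seqPol]
  · rcases lt_trichotomy n j with h | rfl | h
    · simp [seqPol, h.ne, not_le.2 h, not_le.2 (Nat.lt_succ_of_lt h)]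
    · simp [seqPol, QFormula.polAt]
    · obtain ⟨k, rfl⟩ := Nat.exists_eq_add_of_lt h
      have e : j + k + 1 - j = k + 1 := by omega
      have e' : j + k + 1 - (j + 1) = k := by omega
      have e'' : j ≤ j + k + 1 := by omega
      have e3 : j + k + 1 ≠ j := by omega
      simp [seqPol, QFormula.polAt, QFormula.polAt_subst, e, e', e'', e3]

theorem seqPol_inl_succ (A B : QFormula L) (i j : ℕ) : seqPol A B (i + 1) j (Sum.inl i) = none := by
  simp [seqPol]

theorem seqPol_inr_succ (A B : QFormula L) (i j : ℕ) : seqPol A B i (j + 1) (Sum.inr j) = none := by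
  simp [seqPol]

theorem consPos_eq {p p' : Position} {ρ : ℕ → Option Position} :
    (∃ x, consPos p ρ x = some p') ↔ p = p' ∨ ∃ x, ρ x = some p' := by
  constructor
  · rintro ⟨_ | x, h⟩
    · exact Or.inl (Option.some.inj h)
    · exact Or.inr ⟨x, h⟩
  · rintro (rfl | ⟨x, h⟩)
    · exact ⟨0, rfl⟩
    · exact ⟨x + 1, h⟩

namespace SeqProof

variable {Ax : Set (Proposition L × Proposition L)}

theorem Justifies.pol_right {A B : QFormula L} (π : SeqProof Ax A B) : ∀ (h : π.CutFree) (i j : ℕ)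
    (ρ : ℕ → Option Position) (p q : Position), π.Justifies h i j ρ p q →
    seqPol A B i j q = some 1 := by
  induction π with
  | allL t π ih =>
    rintro h i j ρ p q (⟨rfl, -⟩ | H)
    · rw [seqPol_allL _ _ FirstOrder.Language.Term.var, if_pos rfl]
    · have H' := ih h _ _ _ _ _ H
      rw [seqPol_allL, if_neg]
      · exact H'
      rintro rfl
      rw [seqPol_inl_succ] at H'; cases H'
  | exR t π ih =>
    rintro h i j ρ p q (⟨rfl, -⟩ | H)
    · rw [seqPol_exR _ _ FirstOrder.Language.Term.var, if_pos rfl]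
    · have H' := ih h _ _ _ _ _ H
      rw [seqPol_exR, if_neg]
      · exact H'
      rintro rfl
      rw [seqPol_inr_succ] at H'; cases H'
  | allR π ih =>
    intro h i j ρ p q H
    have H' := ih h _ _ _ _ _ H
    rw [seqPol_allR, if_neg]
    · exact H'
    rintro rfl
    rw [seqPol_inr_succ] at H'; cases H'
  | exL π ih =>
    intro h i j ρ p q H
    have H' := ih h _ _ _ _ _ H
    rw [seqPol_exL, if_neg]
    · exact H'
    rintro rfl
    rw [seqPol_inl_succ] at H'; cases H'
  | ax h => intro _ _ _ _ _ _ H; exact H.elim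
  | cut π π' => intro h; exact False.elim h

theorem Justifies.pol_left {A B : QFormula L} (π : SeqProof Ax A B) : ∀ (h : π.CutFree) (i j : ℕ)
    (ρ : ℕ → Option Position) (p q : Position), π.Justifies h i j ρ p q →
    (∃ x, ρ x = some p) ∨ seqPol A B i j p = some (-1) := by
  induction π with
  | allL t π ih =>
    rintro h i j ρ p q (⟨-, x, -, hx⟩ | H)
    · exact Or.inl ⟨x, hx⟩
    · refine (ih h _ _ _ _ _ H).imp_right fun H' => ?_
      rw [seqPol_allL, if_neg]
      · exact H'
      rintro rfl
      rw [seqPol_inl_succ] at H'; cases H'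
  | exR t π ih =>
    rintro h i j ρ p q (⟨-, x, -, hx⟩ | H)
    · exact Or.inl ⟨x, hx⟩
    · refine (ih h _ _ _ _ _ H).imp_right fun H' => ?_
      rw [seqPol_exR, if_neg]
      · exact H'
      rintro rfl
      rw [seqPol_inr_succ] at H'; cases H'
  | allR π ih =>
    intro h i j ρ p q H
    rcases ih h _ _ _ _ _ H with H' | H'
    · rcases consPos_eq.1 H' with rfl | H'
      · exact Or.inr (by rw [seqPol_allR _ _ FirstOrder.Language.Term.var, if_pos rfl])
      · exact Or.inl H'
    · right
      rw [seqPol_allR, if_neg]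
      · exact H'
      rintro rfl
      rw [seqPol_inr_succ] at H'; cases H'
  | exL π ih =>
    intro h i j ρ p q H
    rcases ih h _ _ _ _ _ H with H' | H'
    · rcases consPos_eq.1 H' with rfl | H'
      · exact Or.inr (by rw [seqPol_exL _ _ FirstOrder.Language.Term.var, if_pos rfl])
      · exact Or.inl H'
    · right
      rw [seqPol_exL, if_neg]
      · exact H'
      rintro rfl
      rw [seqPol_inl_succ] at H'; cases H'
  | ax h => intro _ _ _ _ _ _ H; exact H.elim
  | cut π π' => intro h; exact False.elim h

theorem le_rank {A B : QFormula L} (π : SeqProof Ax A B) : ∀ (i j : ℕ) (p : Position),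
    i + j ≤ π.rank i j p := by
  induction π with
  | allL t π ih =>
    intro i j p; have := ih (i + 1) j p; simp only [rank]; split <;> omega
  | exR t π ih =>
    intro i j p; have := ih i (j + 1) p; simp only [rank]; split <;> omega
  | allR π ih =>
    intro i j p; have := ih i (j + 1) p; simp only [rank]; split <;> omega
  | exL π ih =>
    intro i j p; have := ih (i + 1) j p; simp only [rank]; split <;> omega
  | ax h => intro i j p; exact le_rfl
  | cut π π' => intro i j p; exact le_rfl

theorem Justifies.rank_lt {A B : QFormula L} (π : SeqProof Ax A B) : ∀ (h : π.CutFree) (i j : ℕ)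
    (ρ : ℕ → Option Position) (p q : Position), π.Justifies h i j ρ p q →
    (∃ x, ρ x = some p) ∨ π.rank i j p < π.rank i j q := by
  induction π with
  | allL t π ih =>
    rintro h i j ρ p q (⟨-, x, -, hx⟩ | H)
    · exact Or.inl ⟨x, hx⟩
    · refine (ih h _ _ _ _ _ H).imp_right fun H' => ?_
      have hq : q ≠ Sum.inl i := by
        rintro rfl
        have := Justifies.pol_right π h _ _ _ _ _ H
        rw [seqPol_inl_succ] at this; cases this
      have := π.le_rank (i + 1) j q
      simp only [rank, if_neg hq]
      split <;> omega
  | exR t π ih =>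
    rintro h i j ρ p q (⟨-, x, -, hx⟩ | H)
    · exact Or.inl ⟨x, hx⟩
    · refine (ih h _ _ _ _ _ H).imp_right fun H' => ?_
      have hq : q ≠ Sum.inr j := by
        rintro rfl
        have := Justifies.pol_right π h _ _ _ _ _ H
        rw [seqPol_inr_succ] at this; cases this
      have := π.le_rank i (j + 1) q
      simp only [rank, if_neg hq]
      split <;> omega
  | allR π ih =>
    intro h i j ρ p q H
    have hq : q ≠ Sum.inr j := by
      rintro rfl
      have := Justifies.pol_right π h _ _ _ _ _ H
      rw [seqPol_inr_succ] at this; cases this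
    have := π.le_rank i (j + 1) q
    simp only [rank, if_neg hq]
    rcases ih h _ _ _ _ _ H with H' | H'
    · rcases consPos_eq.1 H' with rfl | H'
      · right; rw [if_pos rfl]; omega
      · exact Or.inl H'
    · right; split <;> omega
  | exL π ih =>
    intro h i j ρ p q H
    have hq : q ≠ Sum.inl i := by
      rintro rfl
      have := Justifies.pol_right π h _ _ _ _ _ H
      rw [seqPol_inl_succ] at this; cases this
    have := π.le_rank (i + 1) j q
    simp only [rank, if_neg hq]
    rcases ih h _ _ _ _ _ H with H' | H'
    · rcases consPos_eq.1 H' with rfl | H'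
      · right; rw [if_pos rfl]; omega
      · exact Or.inl H'
    · right; split <;> omega
  | ax h => intro _ _ _ _ _ _ H; exact H.elim
  | cut π π' => intro h; exact False.elim h

theorem rank_lt_left {A B : QFormula L} (π : SeqProof Ax A B) : ∀ (_ : π.CutFree) (i j a b : ℕ),
    i ≤ a → a < b → seqPol A B i j (Sum.inl b) ≠ none →
    π.rank i j (Sum.inl a) < π.rank i j (Sum.inl b) := by
  induction π with
  | allL t π ih =>
    intro h i j a b ha hab hb
    have hb' : (Sum.inl b : Position) ≠ Sum.inl i := by simp; omega
    rw [seqPol_allL, if_neg hb'] at hb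
    have := π.le_rank (i + 1) j (Sum.inl b)
    simp only [rank, if_neg hb']
    split
    · omega
    · rename_i h'
      exact ih h _ _ _ _ (Nat.succ_le_of_lt (lt_of_le_of_ne ha fun e => h' (by rw [e]))) hab hb
  | exR t π ih =>
    intro h i j a b ha hab hb
    rw [seqPol_exR, if_neg Sum.inl_ne_inr] at hb
    simp only [rank, if_neg Sum.inl_ne_inr]
    exact ih h _ _ _ _ ha hab hb
  | allR π ih =>
    intro h i j a b ha hab hb
    rw [seqPol_allR, if_neg Sum.inl_ne_inr] at hb
    simp only [rank, if_neg Sum.inl_ne_inr]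
    exact ih h _ _ _ _ ha hab hb
  | exL π ih =>
    intro h i j a b ha hab hb
    have hb' : (Sum.inl b : Position) ≠ Sum.inl i := by simp; omega
    rw [seqPol_exL, if_neg hb'] at hb
    have := π.le_rank (i + 1) j (Sum.inl b)
    simp only [rank, if_neg hb']
    split
    · omega
    · rename_i h'
      exact ih h _ _ _ _ (Nat.succ_le_of_lt (lt_of_le_of_ne ha fun e => h' (by rw [e]))) hab hb
  | ax h => intro _ i j a b ha hab hb; exact absurd (by simp [seqPol, QFormula.polAt]) hb
  | cut π π' => intro h; exact False.elim h

theorem rank_lt_right {A B : QFormula L} (π : SeqProof Ax A B) : ∀ (_ : π.CutFree) (i j a b : ℕ),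
    j ≤ a → a < b → seqPol A B i j (Sum.inr b) ≠ none →
    π.rank i j (Sum.inr a) < π.rank i j (Sum.inr b) := by
  induction π with
  | allR π ih =>
    intro h i j a b ha hab hb
    have hb' : (Sum.inr b : Position) ≠ Sum.inr j := by simp; omega
    rw [seqPol_allR, if_neg hb'] at hb
    have := π.le_rank i (j + 1) (Sum.inr b)
    simp only [rank, if_neg hb']
    split
    · omega
    · rename_i h'
      exact ih h _ _ _ _ (Nat.succ_le_of_lt (lt_of_le_of_ne ha fun e => h' (by rw [e]))) hab hb
  | exL π ih =>
    intro h i j a b ha hab hb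
    rw [seqPol_exL, if_neg Sum.inr_ne_inl] at hb
    simp only [rank, if_neg Sum.inr_ne_inl]
    exact ih h _ _ _ _ ha hab hb
  | allL t π ih =>
    intro h i j a b ha hab hb
    rw [seqPol_allL, if_neg Sum.inr_ne_inl] at hb
    simp only [rank, if_neg Sum.inr_ne_inl]
    exact ih h _ _ _ _ ha hab hb
  | exR t π ih =>
    intro h i j a b ha hab hb
    have hb' : (Sum.inr b : Position) ≠ Sum.inr j := by simp; omega
    rw [seqPol_exR, if_neg hb'] at hb
    have := π.le_rank i (j + 1) (Sum.inr b)
    simp only [rank, if_neg hb']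
    split
    · omega
    · rename_i h'
      exact ih h _ _ _ _ (Nat.succ_le_of_lt (lt_of_le_of_ne ha fun e => h' (by rw [e]))) hab hb
  | ax h => intro _ i j a b ha hab hb; exact absurd (by simp [seqPol, QFormula.polAt]) hb
  | cut π π' => intro h; exact False.elim h

/-- The position of a move of the game interpreting a sequent. -/
def movePos (A B : QFormula L) : (A.interp.arrow B.interp).Move → Position :=
  Sum.map A.depth B.depth

theorem seqPol_movePos (A B : QFormula L) (m : (A.interp.arrow B.interp).Move) :
    seqPol A B 0 0 (movePos A B m) = some ((A.interp.arrow B.interp).pol m) := by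
  rcases m with m | m
  · exact congrArg (Option.map Neg.neg) (A.polAt_depth m)
  · exact B.polAt_depth m

/-- The strategy on `⟦A⟧ ⊸ ⟦B⟧` interpreting a cut-free proof of `A ⊢ B`. -/
def interp {A B : QFormula L} (π : SeqProof Ax A B) (h : π.CutFree) :
    Strategy (A.interp.arrow B.interp) :=
  have hpol : ∀ m n, π.Justifies h 0 0 (fun _ => none) (movePos A B m) (movePos A B n) →
      (A.interp.arrow B.interp).pol m = -1 ∧ (A.interp.arrow B.interp).pol n = 1 := by
    intro m n H
    have h1 := Justifies.pol_left π h _ _ _ _ _ H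
    have h2 := Justifies.pol_right π h _ _ _ _ _ H
    rw [seqPol_movePos] at h1 h2
    rcases h1 with ⟨_, h1⟩ | h1
    · cases h1
    · exact ⟨Option.some.inj h1, Option.some.inj h2⟩
  have hrank : ∀ m n, Relation.TransGen (fun a b => a ≤ b ∨
      (a = b ∨ π.Justifies h 0 0 (fun _ => none) (movePos A B a) (movePos A B b))) m n →
      m = n ∨ π.rank 0 0 (movePos A B m) < π.rank 0 0 (movePos A B n) := by
    have step : ∀ m n : (A.interp.arrow B.interp).Move, (m ≤ n ∨
        (m = n ∨ π.Justifies h 0 0 (fun _ => none) (movePos A B m) (movePos A B n))) →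
        m = n ∨ π.rank 0 0 (movePos A B m) < π.rank 0 0 (movePos A B n) := by
      rintro m n (H | H | H)
      · have hn := seqPol_movePos A B n
        rcases m with m | m <;> rcases n with n | n
        · rcases A.depth_mono m n (Sum.inl_le_inl_iff.1 H) with rfl | H'
          · exact Or.inl rfl
          · exact Or.inr (rank_lt_left π h 0 0 _ _ (Nat.zero_le _) H' (by
              intro e; rw [show movePos A B (Sum.inl n) = Sum.inl (A.depth n) from rfl, e] at hn
              cases hn))
        · exact absurd H Sum.not_inl_le_inr
        · exact absurd H Sum.not_inr_le_inl
        · rcases B.depth_mono m n (Sum.inr_le_inr_iff.1 H) with rfl | H'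
          · exact Or.inl rfl
          · exact Or.inr (rank_lt_right π h 0 0 _ _ (Nat.zero_le _) H' (by
              intro e; rw [show movePos A B (Sum.inr n) = Sum.inr (B.depth n) from rfl, e] at hn
              cases hn))
      · exact Or.inl H
      · rcases Justifies.rank_lt π h _ _ _ _ _ H with ⟨_, e⟩ | H'
        · cases e
        · exact Or.inr H'
    intro m n H
    induction H with
    | single H => exact step _ _ H
    | tail _ H ih =>
      rcases step _ _ H with rfl | H'
      · exact ih
      · rcases ih with rfl | ih
        · exact Or.inr H'
        · exact Or.inr (ih.trans H')
  { rel := fun m n => m = n ∨ π.Justifies h 0 0 (fun _ => none) (movePos A B m) (movePos A B n)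
    refl := fun _ => Or.inl rfl
    trans := by
      rintro l m n (rfl | H) H'
      · exact H'
      · rcases H' with rfl | H'
        · exact Or.inr H
        · exact absurd ((hpol _ _ H).2.symm.trans (hpol _ _ H').1) (by decide)
    polarity := fun m n H hne => hpol m n (H.resolve_left hne)
    antisymm := by
      rintro m n (rfl | H) H'
      · rfl
      · rcases H' with rfl | H'
        · rfl
        · exact absurd ((hpol _ _ H).2.symm.trans (hpol _ _ H').1) (by decide)
    acyclic := by
      intro m n H H'
      rcases hrank _ _ H with e | h1
      · exact e
      · rcases hrank _ _ H' with e | h2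
        · exact e.symm
        · exact absurd h1 h2.asymm }

end SeqProof

/-- A cyclic strategy on `A ⊸ B` is definable, with respect to a set of axioms, when it is, up to
isomorphisms of games `⟦F⟧ ≅ A` and `⟦G⟧ ≅ B`, the interpretation of a cut-free proof of some
sequent `F ⊢ G`. -/
def Definable (Ax : Set (Proposition L × Proposition L)) {A B : Game.{w}}
    (σ : CyclicStrategy (A.arrow B)) : Prop :=
  ∃ (F G : QFormula L) (i : Game.Iso F.interp A) (j : Game.Iso G.interp B)
    (π : SeqProof Ax F G) (h : π.CutFree), ∀ m n : F.interp.Move ⊕ G.interp.Move,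
      (π.interp h).rel m n ↔
        σ.rel (Sum.map i.toEquiv j.toEquiv m) (Sum.map i.toEquiv j.toEquiv n)

end Interpretation

/-! ## The set of axioms -/

section Axioms

/-- The function symbols `⊤`, `⊥`, `∧` and `∨`. -/
inductive LogicFunction : ℕ → Type
  | top : LogicFunction 0
  | bot : LogicFunction 0
  | and : LogicFunction 2
  | or : LogicFunction 2

/-- The closure of a set of proposition symbols under formal conjunctions and disjunctions, with a
unary symbol `I` and nullary symbols `⊤` and `⊥`. -/
inductive PropSymbol (R : ℕ → Type v) : ℕ → Type v
  | base {n : ℕ} (r : R n) : PropSymbol R n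
  | ofTerm : PropSymbol R 1
  | top : PropSymbol R 0
  | bot : PropSymbol R 0
  | and {m n : ℕ} (p : PropSymbol R m) (q : PropSymbol R n) : PropSymbol R (m + n)
  | or {m n : ℕ} (p : PropSymbol R m) (q : PropSymbol R n) : PropSymbol R (m + n)

/-- The first-order language obtained from `L` by adding the unary proposition symbol `I` and by
closing terms and propositions under formal `⊤`, `⊥`, `∧` and `∨`. -/
def FirstOrder.Language.logicClosure (L : FirstOrder.Language.{u, v}) :
    FirstOrder.Language.{u, v} where
  Functions n := L.Functions n ⊕ LogicFunction n
  Relations := PropSymbol L.Relations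

variable {L : FirstOrder.Language.{u, v}}

namespace LogicTerm

/-- The term `⊤`. -/
def top : L.logicClosure.Term ℕ := .func (Sum.inr LogicFunction.top) ![]

/-- The term `⊥`. -/
def bot : L.logicClosure.Term ℕ := .func (Sum.inr LogicFunction.bot) ![]

/-- The term `s ∧ t`. -/
def and (s t : L.logicClosure.Term ℕ) : L.logicClosure.Term ℕ :=
  .func (Sum.inr LogicFunction.and) ![s, t]

/-- The term `s ∨ t`. -/
def or (s t : L.logicClosure.Term ℕ) : L.logicClosure.Term ℕ :=
  .func (Sum.inr LogicFunction.or) ![s, t]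

end LogicTerm

namespace Proposition

/-- The proposition `I(t)`. -/
def ofTerm (t : L.logicClosure.Term ℕ) : Proposition L.logicClosure := ⟨1, .ofTerm, ![t]⟩

/-- The proposition `⊤`. -/
def top : Proposition L.logicClosure := ⟨0, .top, ![]⟩

/-- The proposition `⊥`. -/
def bot : Proposition L.logicClosure := ⟨0, .bot, ![]⟩

/-- The proposition `P ∧ Q`. -/
def and (P Q : Proposition L.logicClosure) : Proposition L.logicClosure :=
  ⟨P.arity + Q.arity, .and P.sym Q.sym, Fin.append P.args Q.args⟩

/-- The proposition `P ∨ Q`. -/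
def or (P Q : Proposition L.logicClosure) : Proposition L.logicClosure :=
  ⟨P.arity + Q.arity, .or P.sym Q.sym, Fin.append P.args Q.args⟩

/-- The smallest reflexive and transitive relation on propositions which treats the formal `⊤`, `⊥`,
`∧` and `∨` as lattice operations, and for which the identification of a term `t` with the
proposition `I(t)` is compatible with them. -/
inductive Entails : Proposition L.logicClosure → Proposition L.logicClosure → Prop
  | refl (P) : Entails P P
  | trans {P Q R} : Entails P Q → Entails Q R → Entails P R
  | le_top (P) : Entails P top
  | bot_le (P) : Entails bot P
  | le_and {P P₁ P₂} : Entails P P₁ → Entails P P₂ → Entails P (and P₁ P₂)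
  | le_or_left {P P₁ P₂} : Entails P P₁ → Entails P (or P₁ P₂)
  | le_or_right {P P₁ P₂} : Entails P P₂ → Entails P (or P₁ P₂)
  | and_le_left {P P₁ P₂} : Entails P₁ P → Entails (and P₁ P₂) P
  | and_le_right {P P₁ P₂} : Entails P₂ P → Entails (and P₁ P₂) P
  | or_le {P P₁ P₂} : Entails P₁ P → Entails P₂ P → Entails (or P₁ P₂) P
  | top_le_ofTerm : Entails top (ofTerm LogicTerm.top)
  | ofTerm_le_bot : Entails (ofTerm LogicTerm.bot) bot
  | ofTerm_and (s t) : Entails (ofTerm (LogicTerm.and s t)) (and (ofTerm s) (ofTerm t))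
  | and_ofTerm (s t) : Entails (and (ofTerm s) (ofTerm t)) (ofTerm (LogicTerm.and s t))
  | ofTerm_or (s t) : Entails (ofTerm (LogicTerm.or s t)) (or (ofTerm s) (ofTerm t))
  | or_ofTerm (s t) : Entails (or (ofTerm s) (ofTerm t)) (ofTerm (LogicTerm.or s t))

end Proposition

/-- The set of axioms `Ax`. -/
def standardAx (L : FirstOrder.Language.{u, v}) :
    Set (Proposition L.logicClosure × Proposition L.logicClosure) :=
  {x | Proposition.Entails x.1 x.2}

end Axioms

/-!
Every morphism `σ` of `Games` has a ranking, that is a map of the moves to a preorder which is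
strictly monotone with respect to both the causality of the game and `σ`. Rankings of two composable
morphisms order the moves of the middle game `B` in the same way, because `B` is totally ordered;
this is why they combine into a ranking of the composite, in which a move is ranked first by the set
of moves of `B` below it.

Formulas whose matrix is `⊤` interpret every finite filiform game, and their dependencies can be
prescribed at will: the witness `x₁ ∨ … ∨ xₖ ∨ ⊤` depends exactly on `x₁, …, xₖ`. Proof search for
`F ⊢ G` can always introduce the head quantifier of `F` or that of `G`. Otherwise each of them is
justified by a quantifier which is not yet introduced; by acyclicity that quantifier is not behind
the head it justifies, so it is behind the other head, and the two justifications form a cycle.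

Coherence comes from the two-valued model, in which the proposition `I` is the identity.
-/

/-! ## Acyclicity of the morphisms of `Games` -/

/-- The isomorphism `A ⊸ B ≅ A' ⊸ B'` induced by isomorphisms of `A` with `A'` and of `B` with
`B'`. -/
def Game.Iso.arrow {A B : Game.{u}} {A' B' : Game.{v}} (i : Iso A A') (j : Iso B B') :
    Iso (A.arrow B) (A'.arrow B') where
  toEquiv := Equiv.sumCongr i.toEquiv j.toEquiv
  le_iff := by
    rintro (m | m) (n | n)
    · exact Sum.inl_le_inl_iff.trans ((i.le_iff m n).trans Sum.inl_le_inl_iff.symm)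
    · exact iff_of_false Sum.not_inl_le_inr Sum.not_inl_le_inr
    · exact iff_of_false Sum.not_inr_le_inl Sum.not_inr_le_inl
    · exact Sum.inr_le_inr_iff.trans ((j.le_iff m n).trans Sum.inr_le_inr_iff.symm)
  pol_eq := by
    rintro (m | m)
    · exact congrArg Neg.neg (i.pol_eq m)
    · exact j.pol_eq m

theorem Game.Iso.strictMono {A : Game.{u}} {B : Game.{v}} (i : Iso A B) : StrictMono i.toEquiv :=
  strictMono_of_le_iff_le fun m n => (i.le_iff m n).symm

theorem le_iff_le_of_strictMono_of_total {α β : Type*} [PartialOrder α] [Preorder β] {f : α → β}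
    (hf : StrictMono f) (total : ∀ a b : α, a ≤ b ∨ b ≤ a) {a b : α} : f a ≤ f b ↔ a ≤ b := by
  refine ⟨fun h => (total a b).elim id fun hba => ?_, fun h => hf.monotone h⟩
  exact (hba.eq_or_lt.resolve_right fun hlt => h.not_gt (hf hlt)).ge

theorem toLex_lowerCut_lt {α β γ δ : Type*} [Preorder β] [Preorder δ] {r : α → β} (g : γ → α)
    (e : α → WithBot δ) {x y : α} (hxy : r x < r y) (he : y ∈ Set.range g ∨ e x < e y) :
    toLex ({c | r (g c) ≤ r x}, e x) < toLex ({c | r (g c) ≤ r y}, e y) := by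
  have hsub : {c | r (g c) ≤ r x} ⊆ {c | r (g c) ≤ r y} := fun c hc => le_trans hc hxy.le
  rw [Prod.Lex.toLex_lt_toLex]
  refine hsub.lt_or_eq.imp_right fun heq => ⟨heq, he.resolve_left ?_⟩
  rintro ⟨c, rfl⟩
  exact hxy.not_ge (heq.ge le_rfl)

/-- The moves of a game, ordered by the transitive closure of the union of its causality and of a
strategy. -/
def Strategy.Closure {A : Game.{u}} (_ : Strategy A) : Type u := A.Move

instance {A : Game.{u}} (σ : Strategy A) : Preorder σ.Closure where
  le := Relation.TransGen fun a b : A.Move => a ≤ b ∨ σ.rel a b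
  lt m n := Relation.TransGen (fun a b : A.Move => a ≤ b ∨ σ.rel a b) m n ∧ m ≠ n
  le_refl _ := .single (.inl le_rfl)
  le_trans _ _ _ := .trans
  lt_iff_le_not_ge m n := and_congr_right fun h =>
    ⟨fun hne h' => hne (σ.acyclic m n h h'), fun h' e => h' (e ▸ h)⟩

namespace CyclicStrategy

section Ranking

variable {A : Game.{u}}

/-- A ranking of the moves of a game which increases strictly along its causality and along a given
cyclic strategy. -/
structure IsRanking (σ : CyclicStrategy A) {β : Type*} [Preorder β] (r : A.Move → β) : Prop where
  strictMono : StrictMono r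
  rel_lt : ∀ m n, σ.rel m n → m ≠ n → r m < r n

/-- A cyclic strategy is acyclic when it has a ranking, or equivalently when the transitive closure
of its union with the causality of the game is a partial order. -/
def Acyclic (σ : CyclicStrategy A) : Prop :=
  ∃ (β : Type u) (_ : Preorder β) (r : A.Move → β), σ.IsRanking r

theorem acyclic_id (A : Game.{u}) : (CyclicStrategy.id A).Acyclic := by
  refine ⟨A.Move ×ₗ ℤˣ, inferInstance,
    fun m : A.Move ⊕ A.Move => toLex (Sum.elim _root_.id _root_.id m, (A.arrow A).pol m), ?_, ?_⟩
  · rintro (m | m) (n | n) h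
    · exact Prod.Lex.toLex_lt_toLex.2 (.inl (Sum.inl_lt_inl_iff.1 h))
    · exact absurd h Sum.not_inl_lt_inr
    · exact absurd h Sum.not_inr_lt_inl
    · exact Prod.Lex.toLex_lt_toLex.2 (.inl (Sum.inr_lt_inr_iff.1 h))
  · intro m n h hne
    obtain ⟨hm, hn⟩ := (CyclicStrategy.id A).polarity m n h hne
    have hcopy : Sum.elim _root_.id _root_.id m = (Sum.elim _root_.id _root_.id n : A.Move) := by
      rcases h with h | ⟨a, -, rfl, rfl⟩ | ⟨a, -, rfl, rfl⟩
      exacts [absurd h hne, rfl, rfl]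
    exact Prod.Lex.toLex_lt_toLex.2 (.inr ⟨hcopy, (hm.trans_lt (by decide)).trans_eq hn.symm⟩)

end Ranking

section Comap

variable {A : Game.{u}} {B : Game.{v}}

/-- The cyclic strategy on `A` obtained from one on an isomorphic game `B`. -/
def comap (i : Game.Iso A B) (σ : CyclicStrategy B) : CyclicStrategy A where
  rel m n := σ.rel (i.toEquiv m) (i.toEquiv n)
  refl _ := σ.refl _
  trans _ _ _ := σ.trans _ _ _
  polarity m n h hne := by
    rw [← i.pol_eq, ← i.pol_eq]
    exact σ.polarity _ _ h (i.toEquiv.injective.ne hne)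

theorem IsRanking.comap {σ : CyclicStrategy B} {β : Type*} [Preorder β] {r : B.Move → β}
    (hr : σ.IsRanking r) (i : Game.Iso A B) : (σ.comap i).IsRanking (r ∘ i.toEquiv) where
  strictMono := hr.strictMono.comp i.strictMono
  rel_lt _ _ h hne := hr.rel_lt _ _ h (i.toEquiv.injective.ne hne)

end Comap

section Comp

variable {A B C : Game.{u}} {β γ : Type u} [Preorder β] [Preorder γ]

/-- The ranking of a composite made from rankings `r` and `s` of its factors: a move is ranked first
by the set of moves of the middle game `B` below it, then the moves of `B` come before the others,
which are ranked by `r` and by `s`. -/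
def compRank (r : A.Move ⊕ B.Move → β) (s : B.Move ⊕ C.Move → γ) :
    A.Move ⊕ (B.Move ⊕ C.Move) → Set B.Move ×ₗ WithBot (β ⊕ γ)
  | .inl a => toLex ({b | r (.inr b) ≤ r (.inl a)}, WithBot.some (.inl (r (.inl a))))
  | .inr (.inl b) => toLex ({b' | b' ≤ b}, ⊥)
  | .inr (.inr c) => toLex ({b | s (.inl b) ≤ s (.inr c)}, WithBot.some (.inr (s (.inr c))))

theorem compRank_lt_left {r : A.Move ⊕ B.Move → β} (s : B.Move ⊕ C.Move → γ)
    (hr : ∀ b b', r (.inr b) ≤ r (.inr b') ↔ b ≤ b') {x y : A.Move ⊕ B.Move} (hxy : r x < r y) :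
    compRank r s (Sum.map _root_.id Sum.inl x) < compRank r s (Sum.map _root_.id Sum.inl y) := by
  let e : A.Move ⊕ B.Move → WithBot (β ⊕ γ) :=
    Sum.elim (fun a => WithBot.some (.inl (r (.inl a)))) fun _ => ⊥
  have compRank_eq : ∀ z, compRank r s (Sum.map _root_.id Sum.inl z) =
      toLex ({b | r (.inr b) ≤ r z}, e z) := by
    rintro (a | b)
    · rfl
    · simp only [hr]; rfl
  rw [compRank_eq, compRank_eq]
  refine toLex_lowerCut_lt Sum.inr e hxy ?_
  rcases y with a | b
  · rcases x with a' | b'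
    · exact .inr (WithBot.coe_lt_coe.2 (Sum.inl_lt_inl_iff.2 hxy))
    · exact .inr (WithBot.bot_lt_coe _)
  · exact .inl ⟨b, rfl⟩

theorem compRank_lt_right (r : A.Move ⊕ B.Move → β) {s : B.Move ⊕ C.Move → γ}
    (hs : ∀ b b', s (.inl b) ≤ s (.inl b') ↔ b ≤ b') {x y : B.Move ⊕ C.Move} (hxy : s x < s y) :
    compRank r s (Sum.inr x) < compRank r s (Sum.inr y) := by
  let e : B.Move ⊕ C.Move → WithBot (β ⊕ γ) :=
    Sum.elim (fun _ => ⊥) fun c => WithBot.some (.inr (s (.inr c)))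
  have compRank_eq : ∀ z, compRank r s (Sum.inr z) = toLex ({b | s (.inl b) ≤ s z}, e z) := by
    rintro (b | c)
    · simp only [hs]; rfl
    · rfl
  rw [compRank_eq, compRank_eq]
  refine toLex_lowerCut_lt Sum.inl e hxy ?_
  rcases y with b | c
  · exact .inl ⟨b, rfl⟩
  · rcases x with b' | c'
    · exact .inr (WithBot.bot_lt_coe _)
    · exact .inr (WithBot.coe_lt_coe.2 (Sum.inr_lt_inr_iff.2 hxy))

theorem IsRanking.comp {σ : CyclicStrategy (A.arrow B)} {τ : CyclicStrategy (B.arrow C)}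
    {r : A.Move ⊕ B.Move → β} {s : B.Move ⊕ C.Move → γ} (hr : σ.IsRanking r) (hs : τ.IsRanking s)
    (total : ∀ b b' : B.Move, b ≤ b' ∨ b' ≤ b) :
    (σ.comp τ).IsRanking (compRank r s ∘ Sum.map _root_.id Sum.inr) := by
  have r_inr : ∀ b b', r (.inr b) ≤ r (.inr b') ↔ b ≤ b' := fun _ _ =>
    le_iff_le_of_strictMono_of_total (hr.strictMono.comp Sum.inr_strictMono) total
  have s_inl : ∀ b b', s (.inl b) ≤ s (.inl b') ↔ b ≤ b' := fun _ _ =>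
    le_iff_le_of_strictMono_of_total (hs.strictMono.comp Sum.inl_strictMono) total
  have eq_or_lt_of_union : ∀ {x y}, union σ τ x y → x = y ∨ compRank r s x < compRank r s y := by
    rintro _ _ (⟨x, y, h, rfl, rfl⟩ | ⟨x, y, h, rfl, rfl⟩) <;> by_cases hxy : x = y
    · exact .inl (congrArg _ hxy)
    · exact .inr (compRank_lt_left s r_inr (hr.rel_lt _ _ h hxy))
    · exact .inl (congrArg _ hxy)
    · exact .inr (compRank_lt_right r s_inl (hs.rel_lt _ _ h hxy))
  have eq_or_lt_of_transGen : ∀ {x y}, Relation.TransGen (union σ τ) x y →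
      x = y ∨ compRank r s x < compRank r s y := by
    intro x y h
    induction h with
    | single h => exact eq_or_lt_of_union h
    | tail _ h ih =>
      obtain rfl | hlt := eq_or_lt_of_union h
      · exact ih
      · exact .inr (ih.elim (fun e => e ▸ hlt) fun hlt' => hlt'.trans hlt)
  constructor
  · rintro (a | c) (a' | c') h
    · exact compRank_lt_left s r_inr (hr.strictMono (Sum.inl_lt_inl_iff.2 (Sum.inl_lt_inl_iff.1 h)))
    · exact absurd h Sum.not_inl_lt_inr
    · exact absurd h Sum.not_inr_lt_inl
    · exact compRank_lt_right r s_inl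
        (hs.strictMono (Sum.inr_lt_inr_iff.2 (Sum.inr_lt_inr_iff.1 h)))
  · intro m n h hne
    exact (eq_or_lt_of_transGen h).resolve_left
      ((Sum.map_injective.2 ⟨Function.injective_id, Sum.inr_injective⟩).ne hne)

theorem Acyclic.comp {σ : CyclicStrategy (A.arrow B)} {τ : CyclicStrategy (B.arrow C)}
    (hσ : σ.Acyclic) (hτ : τ.Acyclic) (total : ∀ b b' : B.Move, b ≤ b' ∨ b' ≤ b) :
    (σ.comp τ).Acyclic := by
  obtain ⟨_, _, _, hr⟩ := hσ
  obtain ⟨_, _, _, hs⟩ := hτ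
  exact ⟨_, _, _, hr.comp hs total⟩

end Comp

end CyclicStrategy

theorem Strategy.acyclic_toCyclicStrategy {A : Game.{u}} (σ : Strategy A) :
    σ.toCyclicStrategy.Acyclic :=
  ⟨σ.Closure, inferInstance, fun m => m,
    { strictMono := fun _ _ h => ⟨.single (.inl h.le), h.ne⟩
      rel_lt := fun _ _ h hne => ⟨.single (.inr h), hne⟩ }⟩

namespace GamesHom

theorem finiteFiliform {A B : Game.{u}} {σ : CyclicStrategy (A.arrow B)} (hσ : GamesHom σ) :
    A.FiniteFiliform ∧ B.FiniteFiliform := by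
  induction hσ with
  | ofStrategy hA hB _ => exact ⟨hA, hB⟩
  | id hA => exact ⟨hA, hA⟩
  | comp _ _ ihσ ihτ => exact ⟨ihσ.1, ihτ.2⟩

theorem acyclic {A B : Game.{u}} {σ : CyclicStrategy (A.arrow B)} (hσ : GamesHom σ) :
    σ.Acyclic := by
  induction hσ with
  | ofStrategy _ _ σ => exact σ.acyclic_toCyclicStrategy
  | id _ => exact CyclicStrategy.acyclic_id _
  | comp hσ _ ihσ ihτ => exact ihσ.comp ihτ hσ.finiteFiliform.2.total

end GamesHom

/-! ## The axioms -/

section Axioms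

variable {L : FirstOrder.Language.{u, v}}

namespace Proposition

theorem subst_top (s : ℕ → L.logicClosure.Term ℕ) :
    (top : Proposition L.logicClosure).subst s = top :=
  congrArg (Proposition.mk 0 _) (Subsingleton.elim _ _)

theorem subst_bot (s : ℕ → L.logicClosure.Term ℕ) :
    (bot : Proposition L.logicClosure).subst s = bot :=
  congrArg (Proposition.mk 0 _) (Subsingleton.elim _ _)

theorem subst_ofTerm (t : L.logicClosure.Term ℕ) (s : ℕ → L.logicClosure.Term ℕ) :
    (ofTerm t).subst s = ofTerm (t.subst s) :=
  congrArg (Proposition.mk 1 _) (funext fun i => by fin_cases i; rfl)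

theorem subst_args_append {P Q : Proposition L.logicClosure} (s : ℕ → L.logicClosure.Term ℕ) :
    (fun i => (Fin.append P.args Q.args i).subst s) =
      Fin.append (P.subst s).args (Q.subst s).args := by
  funext i
  refine Fin.addCases (fun i => ?_) (fun i => ?_) i
  · rw [Fin.append_left]; exact (Fin.append_left (P.subst s).args (Q.subst s).args i).symm
  · rw [Fin.append_right]; exact (Fin.append_right (P.subst s).args (Q.subst s).args i).symm

theorem subst_and (P Q : Proposition L.logicClosure) (s : ℕ → L.logicClosure.Term ℕ) :
    (and P Q).subst s = and (P.subst s) (Q.subst s) :=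
  congrArg (Proposition.mk (P.arity + Q.arity) _) (subst_args_append s)

theorem subst_or (P Q : Proposition L.logicClosure) (s : ℕ → L.logicClosure.Term ℕ) :
    (or P Q).subst s = or (P.subst s) (Q.subst s) :=
  congrArg (Proposition.mk (P.arity + Q.arity) _) (subst_args_append s)

end Proposition

namespace LogicTerm

theorem subst_top (s : ℕ → L.logicClosure.Term ℕ) : (top (L := L)).subst s = top :=
  congrArg (FirstOrder.Language.Term.func _) (Subsingleton.elim _ _)

theorem subst_bot (s : ℕ → L.logicClosure.Term ℕ) : (bot (L := L)).subst s = bot :=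
  congrArg (FirstOrder.Language.Term.func _) (Subsingleton.elim _ _)

theorem subst_and (t t' : L.logicClosure.Term ℕ) (s : ℕ → L.logicClosure.Term ℕ) :
    (and t t').subst s = and (t.subst s) (t'.subst s) :=
  congrArg (FirstOrder.Language.Term.func _) (funext fun i => by fin_cases i <;> rfl)

theorem subst_or (t t' : L.logicClosure.Term ℕ) (s : ℕ → L.logicClosure.Term ℕ) :
    (or t t').subst s = or (t.subst s) (t'.subst s) :=
  congrArg (FirstOrder.Language.Term.func _) (funext fun i => by fin_cases i <;> rfl)

theorem varFinset_or (t t' : L.logicClosure.Term ℕ) :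
    (or t t').varFinset = t.varFinset ∪ t'.varFinset := by
  ext x
  simp [or, FirstOrder.Language.Term.varFinset, Fin.exists_fin_two]

theorem exists_varFinset_eq (s : Finset ℕ) : ∃ t : L.logicClosure.Term ℕ, t.varFinset = s := by
  induction s using Finset.induction_on with
  | empty => exact ⟨top, rfl⟩
  | insert x s _ ih =>
    obtain ⟨t, rfl⟩ := ih
    exact ⟨or (.var x) t, varFinset_or _ _⟩

end LogicTerm

namespace Proposition

theorem Entails.subst {P Q : Proposition L.logicClosure} (s : ℕ → L.logicClosure.Term ℕ)
    (h : Entails P Q) : Entails (P.subst s) (Q.subst s) := by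
  induction h with
  | refl P => exact .refl _
  | trans _ _ ih ih' => exact .trans ih ih'
  | le_top P => rw [subst_top]; exact .le_top _
  | bot_le P => rw [subst_bot]; exact .bot_le _
  | le_and _ _ ih ih' => rw [subst_and]; exact .le_and ih ih'
  | le_or_left _ ih => rw [subst_or]; exact .le_or_left ih
  | le_or_right _ ih => rw [subst_or]; exact .le_or_right ih
  | and_le_left _ ih => rw [subst_and]; exact .and_le_left ih
  | and_le_right _ ih => rw [subst_and]; exact .and_le_right ih
  | or_le _ _ ih ih' => rw [subst_or]; exact .or_le ih ih'
  | top_le_ofTerm => rw [subst_top, subst_ofTerm, LogicTerm.subst_top]; exact .top_le_ofTerm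
  | ofTerm_le_bot => rw [subst_bot, subst_ofTerm, LogicTerm.subst_bot]; exact .ofTerm_le_bot
  | ofTerm_and t t' =>
    simp only [subst_and, subst_ofTerm, LogicTerm.subst_and]; exact .ofTerm_and _ _
  | and_ofTerm t t' =>
    simp only [subst_and, subst_ofTerm, LogicTerm.subst_and]; exact .and_ofTerm _ _
  | ofTerm_or t t' =>
    simp only [subst_or, subst_ofTerm, LogicTerm.subst_or]; exact .ofTerm_or _ _
  | or_ofTerm t t' =>
    simp only [subst_or, subst_ofTerm, LogicTerm.subst_or]; exact .or_ofTerm _ _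

end Proposition

theorem isAxiomSet_standardAx : IsAxiomSet (standardAx L) where
  refl := .refl
  trans _ _ _ := .trans
  subst _ _ s := .subst s

end Axioms

/-! ## Soundness and coherence -/

section Soundness

variable {L : FirstOrder.Language.{u, v}} {M : Type w}

/-- A valuation of the variables, extended by `x` for a new variable `0`. -/
def consVal (x : M) (e : ℕ → M) : ℕ → M
  | 0 => x
  | n + 1 => e n

variable [L.Structure M]

/-- The truth of a proposition in a structure under a valuation of the variables. -/
def Proposition.Realize (P : Proposition L) (e : ℕ → M) : Prop :=
  FirstOrder.Language.Structure.RelMap P.sym fun i => (P.args i).realize e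

/-- The truth of a formula in a structure under a valuation of the variables. -/
def QFormula.Realize : QFormula L → (ℕ → M) → Prop
  | .atom P, e => P.Realize e
  | .all A, e => ∀ x : M, A.Realize (consVal x e)
  | .ex A, e => ∃ x : M, A.Realize (consVal x e)

theorem Proposition.realize_subst (P : Proposition L) (s : ℕ → L.Term ℕ) (e : ℕ → M) :
    (P.subst s).Realize e ↔ P.Realize fun n => (s n).realize e := by
  simp only [Realize, subst, FirstOrder.Language.Term.realize_subst]

theorem realize_liftSubst (s : ℕ → L.Term ℕ) (x : M) (e : ℕ → M) :
    (fun n => (liftSubst s n).realize (consVal x e)) = consVal x fun n => (s n).realize e := by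
  funext n
  cases n with
  | zero => rfl
  | succ n => exact FirstOrder.Language.Term.realize_relabel

namespace QFormula

theorem realize_subst (A : QFormula L) (s : ℕ → L.Term ℕ) (e : ℕ → M) :
    (A.subst s).Realize e ↔ A.Realize fun n => (s n).realize e := by
  induction A generalizing s e with
  | atom P => exact P.realize_subst s e
  | all A ih => exact forall_congr' fun x => by rw [ih, realize_liftSubst]
  | ex A ih => exact exists_congr fun x => by rw [ih, realize_liftSubst]

theorem realize_inst (A : QFormula L) (t : L.Term ℕ) (e : ℕ → M) :
    (A.inst t).Realize e ↔ A.Realize (consVal (t.realize e) e) := by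
  rw [inst, realize_subst]
  refine iff_of_eq (congrArg A.Realize (funext fun n => ?_))
  cases n <;> rfl

theorem realize_shift (A : QFormula L) (x : M) (e : ℕ → M) :
    A.shift.Realize (consVal x e) ↔ A.Realize e := by
  rw [shift, realize_subst]
  rfl

end QFormula

theorem SeqProof.realize {Ax : Set (Proposition L × Proposition L)}
    (hAx : ∀ P Q, (P, Q) ∈ Ax → ∀ e : ℕ → M, P.Realize e → Q.Realize e) {A B : QFormula L}
    (π : SeqProof Ax A B) (e : ℕ → M) : A.Realize e → B.Realize e := by
  induction π generalizing e with
  | allL t _ ih => exact fun h => ih e ((QFormula.realize_inst _ _ _).2 (h _))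
  | allR _ ih => exact fun h x => ih _ ((QFormula.realize_shift _ _ _).2 h)
  | exL _ ih => exact fun ⟨x, h⟩ => (QFormula.realize_shift _ _ _).1 (ih _ h)
  | exR t _ ih => exact fun h => ⟨_, (QFormula.realize_inst _ _ _).1 (ih e h)⟩
  | ax h => exact hAx _ _ h e
  | cut _ _ ih ih' => exact fun h => ih' e (ih e h)

end Soundness

section Coherence

variable {L : FirstOrder.Language.{u, v}}

/-- The meaning of the logical function symbols on truth values. -/
def LogicFunction.eval : ∀ {n : ℕ}, LogicFunction n → (Fin n → Prop) → Prop
  | _, .top, _ => True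
  | _, .bot, _ => False
  | _, .and, x => x 0 ∧ x 1
  | _, .or, x => x 0 ∨ x 1

/-- The meaning of the proposition symbols on truth values: `I` is the identity and the symbols
without logical meaning are constantly false. -/
def PropSymbol.eval {R : ℕ → Type v} : ∀ {n : ℕ}, PropSymbol R n → (Fin n → Prop) → Prop
  | _, .base _, _ => False
  | _, .ofTerm, x => x 0
  | _, .top, _ => True
  | _, .bot, _ => False
  | _, .and p q, x => p.eval (fun i => x (Fin.castAdd _ i)) ∧ q.eval (fun i => x (Fin.natAdd _ i))
  | _, .or p q, x => p.eval (fun i => x (Fin.castAdd _ i)) ∨ q.eval (fun i => x (Fin.natAdd _ i))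

/-- The two-valued model, in which terms and propositions both denote truth values and the function
symbols without logical meaning are constantly false. -/
instance truthValueStructure : L.logicClosure.Structure Prop where
  funMap f x := Sum.elim (fun _ => False) (fun g => g.eval x) f
  RelMap p x := PropSymbol.eval p x

namespace Proposition

theorem realize_and (P Q : Proposition L.logicClosure) (e : ℕ → Prop) :
    (and P Q).Realize e ↔ P.Realize e ∧ Q.Realize e := by
  simp only [Realize, and, FirstOrder.Language.Structure.RelMap, PropSymbol.eval, Fin.append_left,
    Fin.append_right]

theorem realize_or (P Q : Proposition L.logicClosure) (e : ℕ → Prop) :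
    (or P Q).Realize e ↔ P.Realize e ∨ Q.Realize e := by
  simp only [Realize, or, FirstOrder.Language.Structure.RelMap, PropSymbol.eval, Fin.append_left,
    Fin.append_right]

theorem Entails.realize {P Q : Proposition L.logicClosure} (h : Entails P Q) (e : ℕ → Prop) :
    P.Realize e → Q.Realize e := by
  induction h with
  | refl P => exact id
  | trans _ _ ih ih' => exact ih' ∘ ih
  | le_top P => exact fun _ => trivial
  | bot_le P => exact False.elim
  | le_and _ _ ih ih' => exact fun h => (realize_and _ _ _).2 ⟨ih h, ih' h⟩
  | le_or_left _ ih => exact fun h => (realize_or _ _ _).2 (.inl (ih h))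
  | le_or_right _ ih => exact fun h => (realize_or _ _ _).2 (.inr (ih h))
  | and_le_left _ ih => exact fun h => ih ((realize_and _ _ _).1 h).1
  | and_le_right _ ih => exact fun h => ih ((realize_and _ _ _).1 h).2
  | or_le _ _ ih ih' => exact fun h => ((realize_or _ _ _).1 h).elim ih ih'
  | top_le_ofTerm => exact fun _ => trivial
  | ofTerm_le_bot => exact id
  | ofTerm_and t t' => exact fun h => (realize_and _ _ _).2 h
  | and_ofTerm t t' => exact fun h => (realize_and _ _ _).1 h
  | ofTerm_or t t' => exact fun h => (realize_or _ _ _).2 h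
  | or_ofTerm t t' => exact fun h => (realize_or _ _ _).1 h

end Proposition

theorem isEmpty_seqProof_top_bot :
    IsEmpty (SeqProof (standardAx L) (.atom Proposition.top) (.atom Proposition.bot)) :=
  ⟨fun π => π.realize (fun _ _ => Proposition.Entails.realize) (fun _ => False) trivial⟩

end Coherence

/-! ## Formulas as finite filiform games -/

namespace QFormula

variable {L : FirstOrder.Language.{u, v}}

/-- The number of quantifiers of a formula. -/
def size : QFormula L → ℕ
  | .atom _ => 0
  | .all A => A.size + 1
  | .ex A => A.size + 1

/-- The proposition below the quantifiers of a formula. -/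
def matrix : QFormula L → Proposition L
  | .atom P => P
  | .all A => A.matrix
  | .ex A => A.matrix

/-- The formula with a given matrix and one quantifier for each polarity of a list. -/
def prenex (P : Proposition L) : List ℤˣ → QFormula L
  | [] => .atom P
  | a :: l => if a = 1 then .ex (prenex P l) else .all (prenex P l)

theorem size_subst (A : QFormula L) (s : ℕ → L.Term ℕ) : (A.subst s).size = A.size := by
  induction A generalizing s with
  | atom P => rfl
  | all A ih => exact congrArg Nat.succ (ih _)
  | ex A ih => exact congrArg Nat.succ (ih _)

theorem matrix_subst_of_closed {A : QFormula L} {P : Proposition L} (hA : A.matrix = P)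
    (hP : ∀ s, P.subst s = P) (s : ℕ → L.Term ℕ) : (A.subst s).matrix = P := by
  induction A generalizing s with
  | atom Q =>
    subst hA
    exact hP s
  | all A ih => exact ih hA _
  | ex A ih => exact ih hA _

theorem size_prenex (P : Proposition L) (l : List ℤˣ) : (prenex P l).size = l.length := by
  induction l with
  | nil => rfl
  | cons a l ih => rw [prenex]; split <;> exact congrArg Nat.succ ih

theorem matrix_prenex (P : Proposition L) (l : List ℤˣ) : (prenex P l).matrix = P := by
  induction l with
  | nil => rfl
  | cons a l ih => rw [prenex]; split <;> exact ih

theorem polAt_prenex (P : Proposition L) (l : List ℤˣ) (k : ℕ) :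
    (prenex P l).polAt k = l[k]? := by
  induction l generalizing k with
  | nil => rfl
  | cons a l ih =>
    rw [prenex]
    rcases Int.units_eq_one_or a with rfl | rfl <;> cases k <;> simp [polAt, ih]

theorem interp_le_total : ∀ (A : QFormula L) (m n : A.interp.Move), m ≤ n ∨ n ≤ m
  | .atom _, m, _ => Empty.elim m
  | .all _, .inl _, .inl _ => .inl le_rfl
  | .all _, .inl _, .inr _ => .inl (.sep _ _)
  | .all _, .inr _, .inl _ => .inr (.sep _ _)
  | .all A, .inr m, .inr n => (A.interp_le_total m n).imp .inr .inr
  | .ex _, .inl _, .inl _ => .inl le_rfl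
  | .ex _, .inl _, .inr _ => .inl (.sep _ _)
  | .ex _, .inr _, .inl _ => .inr (.sep _ _)
  | .ex A, .inr m, .inr n => (A.interp_le_total m n).imp .inr .inr

theorem depth_le_depth_iff (A : QFormula L) {m n : A.interp.Move} :
    A.depth m ≤ A.depth n ↔ m ≤ n :=
  le_iff_le_of_strictMono_of_total
    (fun m n h => (A.depth_mono m n h.le).resolve_left h.ne) A.interp_le_total

theorem depth_lt_size : ∀ (A : QFormula L) (m : A.interp.Move), A.depth m < A.size
  | .atom _, m => Empty.elim m
  | .all _, .inl _ => Nat.succ_pos _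
  | .all A, .inr m => Nat.succ_lt_succ (A.depth_lt_size m)
  | .ex _, .inl _ => Nat.succ_pos _
  | .ex A, .inr m => Nat.succ_lt_succ (A.depth_lt_size m)

theorem exists_depth_eq : ∀ (A : QFormula L) {k : ℕ}, k < A.size → ∃ m, A.depth m = k
  | .atom _, _, h => absurd h (Nat.not_lt_zero _)
  | .all _, 0, _ => ⟨.inl (), rfl⟩
  | .all A, _ + 1, h =>
    let ⟨m, hm⟩ := A.exists_depth_eq (Nat.lt_of_succ_lt_succ h)
    ⟨.inr m, congrArg Nat.succ hm⟩
  | .ex _, 0, _ => ⟨.inl (), rfl⟩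
  | .ex A, _ + 1, h =>
    let ⟨m, hm⟩ := A.exists_depth_eq (Nat.lt_of_succ_lt_succ h)
    ⟨.inr m, congrArg Nat.succ hm⟩

/-- The moves of the game interpreting a formula are ordered as its quantifiers are nested. -/
noncomputable def depthIso (A : QFormula L) : A.interp.Move ≃o Fin A.size :=
  RelIso.ofSurjective
    (OrderEmbedding.ofMapLEIff (fun m => (⟨A.depth m, A.depth_lt_size m⟩ : Fin A.size))
      fun _ _ => A.depth_le_depth_iff)
    fun k => (A.exists_depth_eq k.2).imp fun _ => Fin.ext

theorem exists_iso_interp (P : Proposition L) {A : Game.{w}} (hA : A.FiniteFiliform) :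
    ∃ F : QFormula L, F.matrix = P ∧ Nonempty (Game.Iso F.interp A) := by
  classical
  have := hA.finite
  let _ := Fintype.ofFinite A.Move
  let _ : LinearOrder A.Move :=
    { Game.order A with
      le_total := hA.total
      toDecidableLE := Classical.decRel _ }
  let e : Fin (Fintype.card A.Move) ≃o A.Move := Fintype.orderIsoFinOfCardEq A.Move rfl
  let F : QFormula L := prenex P (List.ofFn fun k => A.pol (e k))
  have size_eq : F.size = Fintype.card A.Move := (size_prenex _ _).trans List.length_ofFn
  let f : F.interp.Move ≃o A.Move := (F.depthIso.trans (Fin.castOrderIso size_eq)).trans e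
  have pol_eq : ∀ m, A.pol (f m) = F.interp.pol m := by
    intro m
    have hm : F.depth m < Fintype.card A.Move := (F.depth_lt_size m).trans_eq size_eq
    have h : (List.ofFn fun k => A.pol (e k))[F.depth m]? = some (F.interp.pol m) :=
      (polAt_prenex _ _ _).symm.trans (F.polAt_depth m)
    rw [List.getElem?_ofFn, dif_pos hm] at h
    exact Option.some.inj h
  exact ⟨F, matrix_prenex _ _, ⟨⟨f.toEquiv, fun _ _ => f.le_iff_le, pol_eq⟩⟩⟩

end QFormula

/-! ## Sequentialization -/

theorem update_some_eq_some_iff {α β : Type*} [DecidableEq α] {c : α → Option β} {h q : α} {a b : β}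
    (hc : c h = none) :
    Function.update c h (some a) q = some b ↔ q = h ∧ a = b ∨ c q = some b := by
  by_cases hq : q = h
  · subst hq; simp [hc]
  · simp [hq]

section Tracks

variable {R : Position → Position → Prop} {c : Position → Option ℤˣ} {ρ : ℕ → Option Position}
  {h : Position}

/-- The invariant of proof search for a prescribed justification relation `R`, when `c` gives the
polarities of the quantifiers which are still to be introduced and `ρ` tells which of the others the
variables come from: every justification of a remaining quantifier is either in scope or remains
to be introduced. -/
structure Tracks (R : Position → Position → Prop) (c : Position → Option ℤˣ)
    (ρ : ℕ → Option Position) : Prop where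
  finite_scope : {x | ρ x ≠ none}.Finite
  available : ∀ p q, R p q → c q = some 1 → (∃ x, ρ x = some p) ∨ c p = some (-1)

namespace Tracks

theorem of_update_one (H : Tracks R (Function.update c h (some 1)) ρ) (hc : c h = none) :
    Tracks R c ρ where
  finite_scope := H.finite_scope
  available p q hpq hq := by
    have := H.available p q hpq ((update_some_eq_some_iff hc).2 (.inr hq))
    rw [update_some_eq_some_iff hc] at this
    exact this.imp_right fun hp => hp.resolve_left fun e => absurd e.2 (by decide)

theorem of_update_neg_one (H : Tracks R (Function.update c h (some (-1))) ρ) (hc : c h = none) :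
    Tracks R c (consPos h ρ) where
  finite_scope := by
    refine ((H.finite_scope.image Nat.succ).insert 0).subset ?_
    rintro (_ | x) hx
    · exact .inl rfl
    · exact .inr ⟨x, hx, rfl⟩
  available p q hpq hq := by
    have := H.available p q hpq ((update_some_eq_some_iff hc).2 (.inr hq))
    rw [update_some_eq_some_iff hc] at this
    rw [consPos_eq]
    grind

theorem exists_witness {L : FirstOrder.Language.{u, v}}
    (hL : ∀ s : Finset ℕ, ∃ t : L.Term ℕ, t.varFinset = s) (H : Tracks R c ρ) (hc : c h = some 1)
    (enabled : ∀ p, R p h → c p = none) :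
    ∃ t : L.Term ℕ, ∀ p, (∃ x ∈ t.varFinset, ρ x = some p) ↔ R p h := by
  have finite : {x | ∃ p, ρ x = some p ∧ R p h}.Finite :=
    H.finite_scope.subset fun x ⟨p, hx, _⟩ => by simp [hx]
  obtain ⟨t, ht⟩ := hL finite.toFinset
  refine ⟨t, fun p => ⟨?_, fun hp => ?_⟩⟩
  · rintro ⟨x, hx, hxp⟩
    obtain ⟨p', hxp', hp'⟩ := finite.mem_toFinset.1 (ht ▸ hx)
    cases hxp.symm.trans hxp'
    exact hp'
  · obtain ⟨x, hx⟩ := (H.available p h hp hc).resolve_right (by simp [enabled p hp])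
    exact ⟨x, ht ▸ finite.mem_toFinset.2 ⟨p, hx, hp⟩, hx⟩

end Tracks

end Tracks

section Sequentialization

variable {L : FirstOrder.Language.{u, v}} {Ax : Set (Proposition L × Proposition L)}
  {R : Position → Position → Prop} {A B : QFormula L} {i j : ℕ} {ρ : ℕ → Option Position}

theorem seqPol_all_left (A B : QFormula L) (t : L.Term ℕ) (i j : ℕ) :
    seqPol (.all A) B i j = Function.update (seqPol (A.inst t) B (i + 1) j) (.inl i) (some 1) :=
  funext fun q => (seqPol_allL A B _ i j q).trans (Function.update_apply _ _ _ _).symm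

theorem seqPol_all_right (A B : QFormula L) (i j : ℕ) :
    seqPol A (.all B) i j = Function.update (seqPol A.shift B i (j + 1)) (.inr j) (some (-1)) :=
  funext fun q => (seqPol_allR A B _ i j q).trans (Function.update_apply _ _ _ _).symm

theorem seqPol_ex_left (A B : QFormula L) (i j : ℕ) :
    seqPol (.ex A) B i j = Function.update (seqPol A B.shift (i + 1) j) (.inl i) (some (-1)) :=
  funext fun q => (seqPol_exL A B _ i j q).trans (Function.update_apply _ _ _ _).symm

theorem seqPol_ex_right (A B : QFormula L) (t : L.Term ℕ) (i j : ℕ) :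
    seqPol A (.ex B) i j = Function.update (seqPol A (B.inst t) i (j + 1)) (.inr j) (some 1) :=
  funext fun q => (seqPol_exR A B _ i j q).trans (Function.update_apply _ _ _ _).symm

theorem lt_size_of_polAt_ne_none : ∀ {A : QFormula L} {k : ℕ}, A.polAt k ≠ none → k < A.size
  | .atom _, _, h => absurd rfl h
  | .all _, 0, _ => Nat.succ_pos _
  | .all _, _ + 1, h => Nat.succ_lt_succ (lt_size_of_polAt_ne_none h)
  | .ex _, 0, _ => Nat.succ_pos _
  | .ex _, _ + 1, h => Nat.succ_lt_succ (lt_size_of_polAt_ne_none h)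

theorem head_le_of_seqPol_ne_none {p : Position} (hp : seqPol A B i j p ≠ none) :
    (0 < A.size ∧ .inl i ≤ p) ∨ (0 < B.size ∧ .inr j ≤ p) := by
  rcases p with k | k <;> simp only [seqPol] at hp <;> split at hp
  case inl.isTrue h =>
    refine .inl ⟨?_, Sum.inl_le_inl_iff.2 h⟩
    exact (Nat.zero_le _).trans_lt (lt_size_of_polAt_ne_none (mt Option.map_eq_none_iff.2 hp))
  case inr.isTrue h =>
    exact .inr ⟨(Nat.zero_le _).trans_lt (lt_size_of_polAt_ne_none hp), Sum.inr_le_inr_iff.2 h⟩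
  all_goals exact absurd rfl hp

theorem exists_enabled_head
    (hR : ∀ p q p' q', R p q → q ≤ p' → R p' q' → ¬ q' ≤ p) (hAB : 0 < A.size ∨ 0 < B.size) :
    (0 < A.size ∧ ∀ p, R p (.inl i) → seqPol A B i j p = none) ∨
      (0 < B.size ∧ ∀ p, R p (.inr j) → seqPol A B i j p = none) := by
  by_contra! H
  have blocked_left : 0 < A.size → ∃ p, R p (.inl i) ∧ 0 < B.size ∧ .inr j ≤ p := fun hA => by
    obtain ⟨p, hp, remaining⟩ := H.1 hA
    exact ⟨p, hp, (head_le_of_seqPol_ne_none remaining).resolve_left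
      fun h => hR _ _ _ _ hp h.2 hp h.2⟩
  have blocked_right : 0 < B.size → ∃ p, R p (.inr j) ∧ 0 < A.size ∧ .inl i ≤ p := fun hB => by
    obtain ⟨p, hp, remaining⟩ := H.2 hB
    exact ⟨p, hp, (head_le_of_seqPol_ne_none remaining).resolve_right
      fun h => hR _ _ _ _ hp h.2 hp h.2⟩
  have hA : 0 < A.size := hAB.elim id fun hB => (blocked_right hB).choose_spec.2.1
  obtain ⟨p, hp, hB, hjp⟩ := blocked_left hA
  obtain ⟨p', hp', -, hip'⟩ := blocked_right hB
  exact hR _ _ _ _ hp hip' hp' hjp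

/-- The sequent `A ⊢ B` has a cut-free proof whose witness terms produce, on the quantifiers which
it introduces, the justification relation `R`. The parameters `i`, `j` and `ρ` are those of
`SeqProof.Justifies`. -/
def Realizable (Ax : Set (Proposition L × Proposition L)) (R : Position → Position → Prop)
    (A B : QFormula L) (i j : ℕ) (ρ : ℕ → Option Position) : Prop :=
  ∃ (π : SeqProof Ax A B) (h : π.CutFree),
    ∀ p q, π.Justifies h i j ρ p q ↔ R p q ∧ seqPol A B i j q = some 1

namespace Realizable

theorem ax {P Q : Proposition L} (h : (P, Q) ∈ Ax) :
    Realizable Ax R (.atom P) (.atom Q) i j ρ := by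
  refine ⟨.ax h, trivial, fun p q => ⟨False.elim, fun hq => ?_⟩⟩
  rcases q with k | k <;> simp [seqPol, QFormula.polAt] at hq

theorem allL {t : L.Term ℕ} (ht : ∀ p, (∃ x ∈ t.varFinset, ρ x = some p) ↔ R p (.inl i))
    (H : Realizable Ax R (A.inst t) B (i + 1) j ρ) : Realizable Ax R (.all A) B i j ρ := by
  obtain ⟨π, h, hπ⟩ := H
  refine ⟨.allL t π, h, fun p q => ?_⟩
  change (q = Sum.inl i ∧ ∃ x ∈ t.varFinset, ρ x = some p) ∨ π.Justifies h (i + 1) j ρ p q ↔ _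
  rw [hπ, ht, seqPol_all_left A B t, update_some_eq_some_iff (seqPol_inl_succ _ _ _ _)]
  grind

theorem exR {t : L.Term ℕ} (ht : ∀ p, (∃ x ∈ t.varFinset, ρ x = some p) ↔ R p (.inr j))
    (H : Realizable Ax R A (B.inst t) i (j + 1) ρ) : Realizable Ax R A (.ex B) i j ρ := by
  obtain ⟨π, h, hπ⟩ := H
  refine ⟨.exR t π, h, fun p q => ?_⟩
  change (q = Sum.inr j ∧ ∃ x ∈ t.varFinset, ρ x = some p) ∨ π.Justifies h i (j + 1) ρ p q ↔ _
  rw [hπ, ht, seqPol_ex_right A B t, update_some_eq_some_iff (seqPol_inr_succ _ _ _ _)]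
  grind

theorem allR (H : Realizable Ax R A.shift B i (j + 1) (consPos (.inr j) ρ)) :
    Realizable Ax R A (.all B) i j ρ := by
  obtain ⟨π, h, hπ⟩ := H
  refine ⟨.allR π, h, fun p q => (hπ p q).trans ?_⟩
  rw [seqPol_all_right, update_some_eq_some_iff (seqPol_inr_succ _ _ _ _)]
  simp

theorem exL (H : Realizable Ax R A B.shift (i + 1) j (consPos (.inl i) ρ)) :
    Realizable Ax R (.ex A) B i j ρ := by
  obtain ⟨π, h, hπ⟩ := H
  refine ⟨.exL π, h, fun p q => (hπ p q).trans ?_⟩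
  rw [seqPol_ex_left, update_some_eq_some_iff (seqPol_inl_succ _ _ _ _)]
  simp

end Realizable

theorem realizable {P Q : Proposition L} (hL : ∀ s : Finset ℕ, ∃ t : L.Term ℕ, t.varFinset = s)
    (hR : ∀ p q p' q', R p q → q ≤ p' → R p' q' → ¬ q' ≤ p) (hPQ : (P, Q) ∈ Ax)
    (hP : ∀ s, P.subst s = P) (hQ : ∀ s, Q.subst s = Q) (hA : A.matrix = P) (hB : B.matrix = Q)
    (H : Tracks R (seqPol A B i j) ρ) : Realizable Ax R A B i j ρ := by
  induction hn : A.size + B.size generalizing A B i j ρ with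
  | zero =>
    match A, B with
    | .atom _, .atom _ =>
      cases hA
      cases hB
      exact .ax hPQ
    | .all _, _ | .ex _, _ | _, .all _ | _, .ex _ => simp [QFormula.size] at hn
  | succ n ih =>
    rcases exists_enabled_head (i := i) (j := j) hR (by lia : 0 < A.size ∨ 0 < B.size)
      with ⟨size_pos, enabled⟩ | ⟨size_pos, enabled⟩
    · cases A with
      | atom _ => exact absurd size_pos (lt_irrefl 0)
      | all A =>
        obtain ⟨t, ht⟩ := H.exists_witness hL (by rw [seqPol_all_left A B (.var 0)]; simp) enabled
        rw [seqPol_all_left A B t] at H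
        refine .allL ht (ih (QFormula.matrix_subst_of_closed (A := A) hA hP _) hB
          (H.of_update_one (seqPol_inl_succ _ _ _ _)) ?_)
        simp only [QFormula.size, QFormula.inst, QFormula.size_subst] at hn ⊢
        lia
      | ex A =>
        rw [seqPol_ex_left] at H
        refine .exL (ih hA (QFormula.matrix_subst_of_closed hB hQ _)
          (H.of_update_neg_one (seqPol_inl_succ _ _ _ _)) ?_)
        simp only [QFormula.size, QFormula.shift, QFormula.size_subst] at hn ⊢
        lia
    · cases B with
      | atom _ => exact absurd size_pos (lt_irrefl 0)
      | all B =>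
        rw [seqPol_all_right] at H
        refine .allR (ih (QFormula.matrix_subst_of_closed hA hP _) hB
          (H.of_update_neg_one (seqPol_inr_succ _ _ _ _)) ?_)
        simp only [QFormula.size, QFormula.shift, QFormula.size_subst] at hn ⊢
        lia
      | ex B =>
        obtain ⟨t, ht⟩ := H.exists_witness hL (by rw [seqPol_ex_right A B (.var 0)]; simp) enabled
        rw [seqPol_ex_right A B t] at H
        refine .exR ht (ih hA (QFormula.matrix_subst_of_closed (A := B) hB hQ _)
          (H.of_update_one (seqPol_inr_succ _ _ _ _)) ?_)
        simp only [QFormula.size, QFormula.inst, QFormula.size_subst] at hn ⊢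
        lia

end Sequentialization

/-! ## Definability -/

section Definability

variable {L : FirstOrder.Language.{u, v}} {Ax : Set (Proposition L × Proposition L)}

namespace SeqProof

theorem movePos_le_movePos_iff {F G : QFormula L} {m n : (F.interp.arrow G.interp).Move} :
    movePos F G m ≤ movePos F G n ↔ m ≤ n := by
  rcases m with m | m <;> rcases n with n | n
  · exact Sum.inl_le_inl_iff.trans (F.depth_le_depth_iff.trans Sum.inl_le_inl_iff.symm)
  · exact iff_of_false Sum.not_inl_le_inr Sum.not_inl_le_inr
  · exact iff_of_false Sum.not_inr_le_inl Sum.not_inr_le_inl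
  · exact Sum.inr_le_inr_iff.trans (G.depth_le_depth_iff.trans Sum.inr_le_inr_iff.symm)

theorem movePos_injective (F G : QFormula L) : Function.Injective (movePos F G) :=
  fun _ _ h => (movePos_le_movePos_iff.1 h.le).antisymm (movePos_le_movePos_iff.1 h.ge)

end SeqProof

/-- The justifications of a cyclic strategy, as a relation on the quantifiers of a sequent. -/
def justification {F G : QFormula L} (σ : CyclicStrategy (F.interp.arrow G.interp)) :
    Position → Position → Prop :=
  Relation.Map (fun m n => m ≠ n ∧ σ.rel m n) (SeqProof.movePos F G) (SeqProof.movePos F G)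

section Justification

variable {F G : QFormula L} {σ : CyclicStrategy (F.interp.arrow G.interp)}

theorem justification_movePos_iff {m n : (F.interp.arrow G.interp).Move} :
    justification σ (SeqProof.movePos F G m) (SeqProof.movePos F G n) ↔ m ≠ n ∧ σ.rel m n :=
  Relation.map_apply_apply (SeqProof.movePos_injective F G) (SeqProof.movePos_injective F G) _ _ _

theorem tracks_justification (σ : CyclicStrategy (F.interp.arrow G.interp)) :
    Tracks (justification σ) (seqPol F G 0 0) fun _ => none where
  finite_scope := by simp
  available := by
    rintro _ _ ⟨m, n, ⟨hne, h⟩, rfl, rfl⟩ -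
    exact .inr (by rw [SeqProof.seqPol_movePos, (σ.polarity m n h hne).1])

theorem CyclicStrategy.IsRanking.not_le_of_justification {β : Type*} [Preorder β]
    {r : F.interp.Move ⊕ G.interp.Move → β} (hr : σ.IsRanking r) (p q p' q' : Position)
    (h : justification σ p q) (hqp' : q ≤ p') (h' : justification σ p' q') : ¬ q' ≤ p := by
  obtain ⟨m, n, ⟨hne, hmn⟩, rfl, rfl⟩ := h
  obtain ⟨m', n', ⟨hne', hmn'⟩, rfl, rfl⟩ := h'
  intro hq'p
  have cycle : r m < r m := calc
    r m < r n := hr.rel_lt m n hmn hne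
    _ ≤ r m' := hr.strictMono.monotone (SeqProof.movePos_le_movePos_iff.1 hqp')
    _ < r n' := hr.rel_lt m' n' hmn' hne'
    _ ≤ r m := hr.strictMono.monotone (SeqProof.movePos_le_movePos_iff.1 hq'p)
  exact lt_irrefl _ cycle

theorem Realizable.exists_interp_rel_iff
    (H : Realizable Ax (justification σ) F G 0 0 fun _ => none) :
    ∃ (π : SeqProof Ax F G) (h : π.CutFree), ∀ m n, (π.interp h).rel m n ↔ σ.rel m n := by
  obtain ⟨π, h, hπ⟩ := H
  refine ⟨π, h, fun m n => ?_⟩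
  change (m = n ∨ π.Justifies h 0 0 (fun _ => none) _ _) ↔ _
  rw [hπ, justification_movePos_iff, SeqProof.seqPol_movePos, Option.some_inj]
  constructor
  · rintro (rfl | ⟨⟨-, hmn⟩, -⟩)
    exacts [σ.refl _, hmn]
  · intro hmn
    exact or_iff_not_imp_left.2 fun hne => ⟨⟨hne, hmn⟩, (σ.polarity m n hmn hne).2⟩

end Justification

theorem CyclicStrategy.Acyclic.definable {P Q : Proposition L}
    (hL : ∀ s : Finset ℕ, ∃ t : L.Term ℕ, t.varFinset = s) (hPQ : (P, Q) ∈ Ax)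
    (hP : ∀ s, P.subst s = P) (hQ : ∀ s, Q.subst s = Q) {A B : Game.{w}} (hA : A.FiniteFiliform)
    (hB : B.FiniteFiliform) {σ : CyclicStrategy (A.arrow B)} (hσ : σ.Acyclic) :
    Definable Ax σ := by
  obtain ⟨F, hF, ⟨i⟩⟩ := QFormula.exists_iso_interp P hA
  obtain ⟨G, hG, ⟨j⟩⟩ := QFormula.exists_iso_interp Q hB
  obtain ⟨_, _, r, hr⟩ := hσ
  have hr' := hr.comap (i.arrow j)
  obtain ⟨π, h, hπ⟩ := (realizable hL hr'.not_le_of_justification hPQ hP hQ hF hG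
    (tracks_justification _)).exists_interp_rel_iff
  exact ⟨F, G, i, j, π, h, hπ⟩

end Definability

theorem GamesHom.definable {L : FirstOrder.Language.{u, v}}
    {Ax : Set (Proposition L.logicClosure × Proposition L.logicClosure)}
    (hAx : (Proposition.top, Proposition.top) ∈ Ax) {A B : Game.{w}}
    {σ : CyclicStrategy (A.arrow B)} (hσ : GamesHom σ) : Definable Ax σ :=
  hσ.acyclic.definable LogicTerm.exists_varFinset_eq hAx Proposition.subst_top
    Proposition.subst_top hσ.finiteFiliform.1 hσ.finiteFiliform.2

theorem mainTheorem5_general (L : FirstOrder.Language.{u, v}) :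
    IsAxiomSet (standardAx L) ∧
    IsEmpty (SeqProof (standardAx L) (.atom Proposition.top) (.atom Proposition.bot)) ∧
    ∀ Ax : Set (Proposition L.logicClosure × Proposition L.logicClosure),
      (Proposition.top, Proposition.top) ∈ Ax →
      ∀ (A B : Game.{w}) (σ : CyclicStrategy (A.arrow B)), GamesHom σ → Definable Ax σ :=
  ⟨isAxiomSet_standardAx, isEmpty_seqProof_top_bot, fun _ hAx _ _ _ hσ => hσ.definable hAx⟩

theorem mainTheorem5 (L : FirstOrder.Language.{u, v}) :
    IsAxiomSet (standardAx L) ∧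
    IsEmpty (SeqProof (standardAx L) (.atom Proposition.top) (.atom Proposition.bot)) ∧
    ∀ Ax : Set (Proposition L.logicClosure × Proposition L.logicClosure),
      IsAxiomSet Ax → standardAx L ⊆ Ax →
      ∀ (A B : Game.{w}) (σ : CyclicStrategy (A.arrow B)), GamesHom σ → Definable Ax σ := by
  obtain ⟨isAxiomSet, coherent, definable⟩ := mainTheorem5_general L
  exact ⟨isAxiomSet, coherent, fun Ax hAx _ => definable Ax (hAx.refl Proposition.top)⟩
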